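/- **Theorem A.** Let a group $G$ act (on the left) on a non-empty set $S$, and let $K=\ker(G\curvearrowright S)$. Let $C=\{0,1\}^{\mathbb N}$ and let $C^S(n)$ be the disjoint union of $n$ copies of $C^S$. A dyadic brick in a copy of $C^S$ is a set $\{\kappa : \psi(s)\text{ is a prefix of }\kappa(s)\ \text{for all } s\in S\}$, where $\psi$ assigns to each $s\in S$ a finite binary word, empty for all but finitely many $s$; it is identified with $C^S$ by the canonical homeomorphism $\kappa\mapsto(s\mapsto\psi(s)\cdot\kappa(s))$. Let $S\mathcal V$ be the groupoid of all homeomorphisms $C^S(m)\to C^S(n)$ obtained by partitioning domain and range into the same finite number of dyadic bricks and mapping the domain bricks to the range bricks by canonical homeomorphisms. It contains the simple splits $x_s\colon C^S\to C^S(2)$ ($s\in S$), which send the brick of all $\kappa$ with $\kappa(s)$ starting with $0$ (resp. $1$) canonically to the first (resp. second) copy, and the permutations $p_\sigma$ of copies ($\sigma\in\Sigma_n$), where $p_\sigma$ sends the $i$-th copy to the $\sigma(i)$-th. A multicolored forest is an element of the smallest subset of $S\mathcal V$ that contains the identities and the simple splits and is closed under composition and direct sums (placing maps side by side); a multicolored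 tree is a multicolored forest with domain $C^S$. Let $S\mathcal V_G$ be the groupoid with object set $\mathbb N$ generated by $S\mathcal V$ and a copy of $G^n$ at each object $n$, subject to the relations, closed under composition and direct sums, generated by $x_{g.s}\circ g=(g\oplus g)\circ x_s$ ($s\in S$, $g\in G$) and $(g_1\oplus\cdots\oplus g_n)\circ p_\sigma=p_\sigma\circ(g_{\sigma(1)}\oplus\cdots\oplus g_{\sigma(n)})$ ($\sigma\in\Sigma_n$, $g_i\in G$). The abstract twisted Brin–Thompson group $SV_G$ is the group of arrows of $S\mathcal V_G$ from $1$ to $1$. The canonical kernel $SK_G$ is the kernel of the homomorphism $SV_G\to SV_{G/K}$ that replaces every label $g\in G$ by $gK$. Then $SK_G$ consists exactly of the elements $T^{-1}\circ(k_1,\dots,k_n)\circ T$ with $T\colon C^S\to C^S(n)$ a multicolored tree and $k_1,\dots,k_n\in K$; it is a proper normal subgroup of $SV_G$; and every proper normal subgroup of $SV_G$ is contained in $SK_G$. In particular $SV_G$ is relatively simple: it has a proper normal subgroup that contains every proper normal subgroup. -/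

import Mathlib

namespace BrinThompson

universe u v w

/-! ## Cantor powers, dyadic bricks and the Brin–Thompson groupoid -/

/-- `C^S(n)`: the disjoint union of `n` copies of `C^S`, where `C = {0,1}^ℕ`.
A point is a copy number together with a function `S → C`; the topology is the product one. -/
abbrev CantorPower (S : Type v) (n : ℕ) : Type v := Fin n × (S → ℕ → Bool)

/-- Concatenation of a finite binary word with an infinite one. -/
def prepend (w : List Bool) (x : ℕ → Bool) : ℕ → Bool :=
  fun i => if h : i < w.length then w[i] else x (i - w.length)

/-- The datum of a dyadic brick of `C^S(n)`: one of the copies of `C^S`, and a finite binary word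
`ψ s` for every `s`, empty for all but finitely many `s`. -/
structure Brick (S : Type v) (n : ℕ) where
  copy : Fin n
  word : S → List Bool
  finite : {s | word s ≠ []}.Finite

/-- The set of points of a dyadic brick: `word s` is a prefix of the coordinate `s`. -/
def Brick.carrier {S : Type v} {n : ℕ} (B : Brick S n) : Set (CantorPower S n) :=
  {p | p.1 = B.copy ∧ ∀ s, ∃ x, p.2 s = prepend (B.word s) x}

/-- The canonical homeomorphism from `C^S` to a dyadic brick. -/
def Brick.canon {S : Type v} {n : ℕ} (B : Brick S n) (κ : S → ℕ → Bool) : CantorPower S n :=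
  (B.copy, fun s => prepend (B.word s) (κ s))

/-- The finite family `a` of dyadic bricks partitions `C^S(n)`. -/
def IsPartition {S : Type v} {n : ℕ} {ι : Type*} (a : ι → Brick S n) : Prop :=
  ∀ p : CantorPower S n, ∃! i, p ∈ (a i).carrier

/-- `h` is obtained by partitioning domain and range into the same number of dyadic bricks and
mapping the domain ones to the range ones via canonical homeomorphisms. -/
def IsPiecewiseCanonical {S : Type v} {m n : ℕ} (h : CantorPower S m ≃ₜ CantorPower S n) : Prop :=
  ∃ (N : ℕ) (a : Fin N → Brick S m) (b : Fin N → Brick S n),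
    IsPartition a ∧ IsPartition b ∧ ∀ i κ, h ((a i).canon κ) = (b i).canon κ

/-- The elements of the Brin–Thompson groupoid from `C^S(m)` to `C^S(n)`. -/
structure BT (S : Type v) (m n : ℕ) where
  homeo : CantorPower S m ≃ₜ CantorPower S n
  piecewise : IsPiecewiseCanonical homeo

/-! ### Closure under identities, inverses and composition -/

theorem prepend_append (w w' : List Bool) (x : ℕ → Bool) :
    prepend (w ++ w') x = prepend w (prepend w' x) := by
  funext i
  simp only [prepend, List.length_append, List.getElem_append]
  split_ifs <;> first | rfl | omega | (congr 1; omega)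

theorem prepend_nil (x : ℕ → Bool) : prepend [] x = x := by
  funext i; simp [prepend]

theorem prepend_injective (w : List Bool) : Function.Injective (prepend w) := by
  intro x y h
  funext i
  have := congrFun h (i + w.length)
  simpa [prepend] using this

theorem prepend_compat {w w' : List Bool} {x x' : ℕ → Bool} (h : prepend w x = prepend w' x') :
    w ++ w'.drop w.length = w' ++ w.drop w'.length ∧
      ∃ y, x = prepend (w'.drop w.length) y := by
  have key : ∀ i (h1 : i < w.length) (h2 : i < w'.length), w[i] = w'[i] := by
    intro i h1 h2
    have := congrFun h i
    simpa [prepend, h1, h2] using this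
  rcases le_total w.length w'.length with hl | hl
  · have hpre : w' = w ++ w'.drop w.length := by
      apply List.ext_getElem
      · simp; omega
      · intro i h1 h2
        rw [List.getElem_append]
        split_ifs with h3
        · exact (key i h3 h1).symm
        · simp only [List.getElem_drop]; congr 1; omega
    refine ⟨?_, x', ?_⟩
    · rw [← hpre, List.drop_eq_nil_of_le hl, List.append_nil]
    · apply prepend_injective w
      rw [← prepend_append, ← hpre, h]
  · have hpre : w = w' ++ w.drop w'.length := by
      apply List.ext_getElem
      · simp; omega
      · intro i h1 h2
        rw [List.getElem_append]
        split_ifs with h3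
        · exact key i h1 h3
        · simp only [List.getElem_drop]; congr 1; omega
    refine ⟨?_, x, ?_⟩
    · rw [← hpre, List.drop_eq_nil_of_le hl, List.append_nil]
    · rw [List.drop_eq_nil_of_le hl, prepend_nil]

theorem Brick.mem_carrier {S : Type v} {n : ℕ} (B : Brick S n) (p : CantorPower S n) :
    p ∈ B.carrier ↔ ∃ κ, B.canon κ = p := by
  constructor
  · rintro ⟨h1, h2⟩
    choose κ hκ using h2
    exact ⟨κ, Prod.ext h1.symm (funext fun s => (hκ s).symm)⟩
  · rintro ⟨κ, rfl⟩
    exact ⟨rfl, fun s => ⟨κ s, rfl⟩⟩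

theorem IsPartition.image {S : Type v} {m n : ℕ} {ι : Type*}
    (h : CantorPower S m ≃ₜ CantorPower S n) {a : ι → Brick S m} {b : ι → Brick S n}
    (ha : IsPartition a) (hab : ∀ i κ, h ((a i).canon κ) = (b i).canon κ) : IsPartition b := by
  have key : ∀ i q, q ∈ (b i).carrier ↔ h.symm q ∈ (a i).carrier := by
    intro i q
    simp only [Brick.mem_carrier, ← hab]
    exact exists_congr fun κ => h.toEquiv.eq_symm_apply.symm
  intro q
  simpa only [key] using ha (h.symm q)

/-- It is enough to have a partition of the domain, indexed by any finite type. -/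
theorem IsPiecewiseCanonical.mk {S : Type v} {m n : ℕ} {ι : Type*} [Finite ι]
    (h : CantorPower S m ≃ₜ CantorPower S n) (a : ι → Brick S m) (b : ι → Brick S n)
    (ha : IsPartition a) (hab : ∀ i κ, h ((a i).canon κ) = (b i).canon κ) :
    IsPiecewiseCanonical h := by
  obtain ⟨N, ⟨e⟩⟩ := Finite.exists_equiv_fin ι
  have ha' : IsPartition (a ∘ e.symm) := by
    intro p
    obtain ⟨i, hi, hu⟩ := ha p
    refine ⟨e i, by simpa using hi, fun j hj => ?_⟩
    rw [← hu _ hj]; simp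
  exact ⟨N, a ∘ e.symm, b ∘ e.symm, ha', ha'.image h fun i κ => hab _ κ, fun i κ => hab _ κ⟩

/-- The copy number `i` of `C^S` inside `C^S(n)`, as a dyadic brick. -/
def Brick.whole (S : Type v) {n : ℕ} (i : Fin n) : Brick S n := ⟨i, fun _ => [], by simp⟩

theorem Brick.whole_canon {S : Type v} {n : ℕ} (i : Fin n) (κ : S → ℕ → Bool) :
    (Brick.whole S i).canon κ = (i, κ) := by
  simp [Brick.whole, Brick.canon, prepend_nil]

theorem isPartition_whole (S : Type v) (n : ℕ) : IsPartition (fun i : Fin n => Brick.whole S i) := by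
  rintro ⟨i, κ⟩
  refine ⟨i, (Brick.mem_carrier _ _).2 ⟨κ, Brick.whole_canon i κ⟩, ?_⟩
  intro j hj
  exact hj.1.symm

/-- The brick of `B` obtained by appending further words. -/
def Brick.append {S : Type v} {n : ℕ} (B : Brick S n) (u : S → List Bool)
    (hu : {s | u s ≠ []}.Finite) : Brick S n :=
  ⟨B.copy, fun s => B.word s ++ u s, (B.finite.union hu).subset fun s hs => by
    by_contra hc
    simp only [Set.mem_union, Set.mem_ofPred_eq, not_or, not_not] at hc
    exact hs (by simp [hc.1, hc.2])⟩

theorem Brick.append_canon {S : Type v} {n : ℕ} (B : Brick S n) (u : S → List Bool)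
    (hu : {s | u s ≠ []}.Finite) (κ : S → ℕ → Bool) :
    (B.append u hu).canon κ = B.canon (fun s => prepend (u s) (κ s)) := by
  simp [Brick.append, Brick.canon, prepend_append]

theorem Brick.finite_drop {S : Type v} {n : ℕ} (B : Brick S n) (l : S → ℕ) :
    {s | (B.word s).drop (l s) ≠ []}.Finite :=
  B.finite.subset fun s hs hc => hs (by simp [hc])

theorem IsPiecewiseCanonical.comp {S : Type v} {l m n : ℕ}
    {g : CantorPower S m ≃ₜ CantorPower S n} {f : CantorPower S l ≃ₜ CantorPower S m}
    (hg : IsPiecewiseCanonical g) (hf : IsPiecewiseCanonical f) :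
    IsPiecewiseCanonical (f.trans g) := by
  obtain ⟨N, a, b, ha, -, hab⟩ := hf
  obtain ⟨M, c, d, hc, -, hcd⟩ := hg
  let U : Fin N → Fin M → S → List Bool := fun i j s =>
    ((c j).word s).drop ((b i).word s).length
  let V : Fin N → Fin M → S → List Bool := fun i j s =>
    ((b i).word s).drop ((c j).word s).length
  have hU : ∀ i j, {s | U i j s ≠ []}.Finite := fun i j => (c j).finite_drop _
  have hV : ∀ i j, {s | V i j s ≠ []}.Finite := fun i j => (b i).finite_drop _
  let ι := {p : Fin N × Fin M // (b p.1).copy = (c p.2).copy ∧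
    ∀ s, (b p.1).word s ++ U p.1 p.2 s = (c p.2).word s ++ V p.1 p.2 s}
  have hfi : ∀ (p : ι) κ, f (((a p.1.1).append (U p.1.1 p.1.2) (hU _ _)).canon κ) =
      (c p.1.2).canon fun s => prepend (V p.1.1 p.1.2 s) (κ s) := by
    intro p κ
    rw [Brick.append_canon, hab]
    refine Prod.ext p.2.1 (funext fun s => ?_)
    simp only [Brick.canon, ← prepend_append, p.2.2 s]
  refine IsPiecewiseCanonical.mk (ι := ι) _
    (fun p => (a p.1.1).append (U p.1.1 p.1.2) (hU _ _))
    (fun p => (d p.1.2).append (V p.1.1 p.1.2) (hV _ _)) ?_ ?_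
  · intro p
    obtain ⟨i, hi, hiu⟩ := ha p
    obtain ⟨κ, rfl⟩ := (Brick.mem_carrier _ _).1 hi
    obtain ⟨j, hj, hju⟩ := hc (f ((a i).canon κ))
    obtain ⟨κ', hκ'⟩ := (Brick.mem_carrier _ _).1 hj
    have hκ := hκ'
    rw [hab] at hκ
    have hs : ∀ s, prepend ((b i).word s) (κ s) = prepend ((c j).word s) (κ' s) :=
      fun s => (congrFun (congrArg Prod.snd hκ) s).symm
    have hy : ∀ s, ∃ y, κ s = prepend (U i j s) y := fun s => (prepend_compat (hs s)).2
    choose y hy using hy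
    refine ⟨⟨(i, j), (congrArg Prod.fst hκ).symm, fun s => (prepend_compat (hs s)).1⟩, ?_, ?_⟩
    · refine (Brick.mem_carrier _ _).2 ⟨y, ?_⟩
      rw [Brick.append_canon]
      exact congrArg _ (funext fun s => (hy s).symm)
    · intro q hq
      obtain ⟨z, hz⟩ := (Brick.mem_carrier _ _).1 hq
      have h1 : q.1.1 = i := hiu _ ((Brick.mem_carrier _ _).2 ⟨_, by
        rw [← hz, Brick.append_canon]⟩)
      have h2 : q.1.2 = j := hju _ ((Brick.mem_carrier _ _).2 ⟨_, by
        rw [← hz, hfi q z]⟩)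
      exact Subtype.ext (Prod.ext h1 h2)
  · intro p κ
    rw [Homeomorph.trans_apply, hfi, hcd, Brick.append_canon]

/-- The identity of `C^S(n)`. -/
def BT.id (S : Type v) (n : ℕ) : BT S n n where
  homeo := Homeomorph.refl _
  piecewise := .mk _ (fun i => Brick.whole S i) (fun i => Brick.whole S i)
    (isPartition_whole S n) fun _ _ => rfl

/-- Composition `g ∘ f` in the Brin–Thompson groupoid. -/
def BT.comp {S : Type v} {l m n : ℕ} (g : BT S m n) (f : BT S l m) : BT S l n where
  homeo := f.homeo.trans g.homeo
  piecewise := g.piecewise.comp f.piecewise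

/-- Inverses in the Brin–Thompson groupoid. -/
def BT.inv {S : Type v} {m n : ℕ} (f : BT S m n) : BT S n m where
  homeo := f.homeo.symm
  piecewise := by
    obtain ⟨N, a, b, ha, hb, hab⟩ := f.piecewise
    exact ⟨N, b, a, hb, ha, fun i κ => by rw [← hab, Homeomorph.symm_apply_apply]⟩

/-- The permutation `p_σ`, which sends copy `i` of `C^S` to copy `σ i`. -/
def BT.perm (S : Type v) {n : ℕ} (σ : Equiv.Perm (Fin n)) : BT S n n where
  homeo :=
    { toFun := fun p => (σ p.1, p.2)
      invFun := fun p => (σ.symm p.1, p.2)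
      left_inv := fun p => by simp
      right_inv := fun p => by simp
      continuous_toFun := (continuous_of_discreteTopology.comp continuous_fst).prodMk continuous_snd
      continuous_invFun :=
        (continuous_of_discreteTopology.comp continuous_fst).prodMk continuous_snd }
  piecewise := .mk _ (fun i => Brick.whole S i) (fun i => Brick.whole S (σ i))
    (isPartition_whole S n) fun i κ => by simp [Brick.whole_canon]

/-! ### Simple splits and multicolored forests -/

open Classical in
/-- Cut the copy `k` of `C^S` in `C^S(n)` into two halves in direction `s`, and number the resulting
`n + 1` bricks in order: those numbered `k` and `k + 1` are the halves of copy `k` on which the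
coordinate `s` starts with `0` and with `1`, and the others are whole copies of `C^S`. -/
noncomputable def splitBrick {S : Type v} {n : ℕ} (k : Fin n) (s : S) (j : Fin (n + 1)) :
    Brick S n where
  copy := k.predAbove j
  word := fun t =>
    if t = s then
      if j = k.castSucc then [false] else if j = k.succ then [true] else []
    else []
  finite := (Set.finite_singleton s).subset fun t ht => by
    by_contra hc
    exact ht (if_neg hc)

theorem prepend_singleton_eq (b : Bool) (x : ℕ → Bool) (h : x 0 = b) :
    prepend [b] (fun i => x (i + 1)) = x := by
  funext i
  cases i with
  | zero => simp [prepend, h]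
  | succ i => simp [prepend]

theorem predAbove_eq_self {n : ℕ} {k : Fin n} {j : Fin (n + 1)} (h : k.predAbove j = k) :
    j = k.castSucc ∨ j = k.succ := by
  unfold Fin.predAbove at h
  split_ifs at h with h1
  · right; rw [← h]; simp
  · left; rw [← h]; simp

theorem predAbove_inj {n : ℕ} {k i : Fin n} (hik : i ≠ k) {j j' : Fin (n + 1)}
    (h : k.predAbove j = i) (h' : k.predAbove j' = i) : j = j' := by
  have hi : (i : ℕ) ≠ k := fun h => hik (Fin.ext h)
  unfold Fin.predAbove at h h'
  apply Fin.ext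
  split_ifs at h h' with h1 h2 h2 <;> 
    rw [Fin.lt_def] at h1 h2 <;> rw [Fin.ext_iff] at h h' <;>
    simp only [Fin.val_castSucc, Fin.val_pred, Fin.coe_castPred] at h1 h2 h h' <;> omega

theorem isPartition_splitBrick {S : Type v} {n : ℕ} (k : Fin n) (s : S) :
    IsPartition (splitBrick k s) := by
  rintro ⟨i, κ⟩
  have hne : k.castSucc ≠ k.succ := (Fin.castSucc_lt_succ).ne
  by_cases hik : i = k
  · subst hik
    have hcs : (κ s 0 = false ∧ (i, κ) ∈ (splitBrick i s i.castSucc).carrier) ∨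
        (κ s 0 = true ∧ (i, κ) ∈ (splitBrick i s i.succ).carrier) := by
      cases h : κ s 0
      · left
        refine ⟨rfl, by simp [splitBrick], fun t => ?_⟩
        by_cases hts : t = s
        · subst hts
          exact ⟨fun i => κ t (i + 1), by simp [splitBrick, prepend_singleton_eq _ _ h]⟩
        · exact ⟨κ t, by simp [splitBrick, hts, prepend_nil]⟩
      · right
        refine ⟨rfl, by simp [splitBrick], fun t => ?_⟩
        by_cases hts : t = s
        · subst hts
          exact ⟨fun i => κ t (i + 1), by
            simp [splitBrick, hne.symm, prepend_singleton_eq _ _ h]⟩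
        · exact ⟨κ t, by simp [splitBrick, hts, prepend_nil]⟩
    have h0 : (i, κ) ∈ (splitBrick i s i.castSucc).carrier → κ s 0 = false := by
      rintro ⟨-, h⟩
      obtain ⟨x, hx⟩ := h s
      have := congrFun hx 0
      simpa [splitBrick, prepend] using this
    have h1 : (i, κ) ∈ (splitBrick i s i.succ).carrier → κ s 0 = true := by
      rintro ⟨-, h⟩
      obtain ⟨x, hx⟩ := h s
      have := congrFun hx 0
      simpa [splitBrick, prepend, hne.symm] using this
    rcases hcs with ⟨hv, hm⟩ | ⟨hv, hm⟩
    · refine ⟨_, hm, fun j hj => ?_⟩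
      rcases predAbove_eq_self (k := i) (j := j) hj.1.symm with rfl | rfl
      · rfl
      · rw [h1 hj] at hv; cases hv
    · refine ⟨_, hm, fun j hj => ?_⟩
      rcases predAbove_eq_self (k := i) (j := j) hj.1.symm with rfl | rfl
      · rw [h0 hj] at hv; cases hv
      · rfl
  · obtain ⟨j, hj⟩ := Fin.predAbove_surjective k i
    have hw : j ≠ k.castSucc ∧ j ≠ k.succ := by
      constructor <;> rintro rfl <;> simp at hj <;> exact hik hj.symm
    refine ⟨j, ⟨hj.symm, fun t => ⟨κ t, by simp [splitBrick, hw.1, hw.2, prepend_nil]⟩⟩, ?_⟩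
    intro j' hj'
    exact predAbove_inj hik hj'.1.symm hj

theorem Brick.canon_injective {S : Type v} {n : ℕ} (B : Brick S n) :
    Function.Injective B.canon := by
  intro κ κ' h
  funext s
  exact prepend_injective _ (congrFun (congrArg Prod.snd h) s)

theorem Brick.continuous_canon {S : Type v} {n : ℕ} (B : Brick S n) : Continuous B.canon := by
  refine continuous_const.prodMk (continuous_pi fun s => continuous_pi fun i => ?_)
  by_cases h : i < (B.word s).length
  · simp only [prepend, h, dite_true]; exact continuous_const
  · simp only [prepend, h, dite_false]; fun_prop

/-- The inverse of the split: copy `j` is sent canonically onto the `j`-th brick. -/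
noncomputable def unsplit {S : Type v} {n : ℕ} (k : Fin n) (s : S) :
    CantorPower S (n + 1) ≃ CantorPower S n :=
  Equiv.ofBijective (fun p => (splitBrick k s p.1).canon p.2) (by
    constructor
    · rintro ⟨j, κ⟩ ⟨j', κ'⟩ h
      have : j = j' := (isPartition_splitBrick k s ((splitBrick k s j).canon κ)).unique
        ((Brick.mem_carrier _ _).2 ⟨_, rfl⟩) ((Brick.mem_carrier _ _).2 ⟨_, h.symm⟩)
      subst this
      exact congrArg _ (Brick.canon_injective _ h)
    · intro p
      obtain ⟨j, hj, -⟩ := isPartition_splitBrick k s p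
      obtain ⟨κ, hκ⟩ := (Brick.mem_carrier _ _).1 hj
      exact ⟨(j, κ), hκ⟩)

theorem continuous_unsplit {S : Type v} {n : ℕ} (k : Fin n) (s : S) :
    Continuous (unsplit k s) :=
  continuous_prod_of_discrete_left.2 fun j => (splitBrick k s j).continuous_canon

/-- The direct sum `1_{k-1} ⊕ x_s ⊕ 1_{n-k}`, where `x_s` is the simple split in direction `s`:
the homeomorphism from `C^S(n)` to `C^S(n + 1)` that sends the `j`-th brick of `splitBrick k s`
canonically to copy `j`. The simple split `x_s` itself is the case `n = 1`. -/
noncomputable def BT.split {S : Type v} {n : ℕ} (k : Fin n) (s : S) : BT S n (n + 1) where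
  homeo := (Continuous.homeoOfEquivCompactToT2 (continuous_unsplit k s)).symm
  piecewise := .mk _ (splitBrick k s) (fun j => Brick.whole S j) (isPartition_splitBrick k s)
    fun j κ => by
      rw [Brick.whole_canon, Homeomorph.symm_apply_eq]
      rfl

/-- Multicolored forests: the elements of the Brin–Thompson groupoid generated, under composition
and direct sums, by identities and simple splits; equivalently, the composites of the maps
`1 ⊕ x_s ⊕ 1`. The roots are the copies in the domain and the leaves the copies in the range. -/
inductive IsForest {S : Type v} : ∀ {m n : ℕ}, BT S m n → Prop
  | id (n : ℕ) : IsForest (BT.id S n)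
  | split {m n : ℕ} (F : BT S m n) (k : Fin n) (s : S) :
      IsForest F → IsForest ((BT.split k s).comp F)

/-! ## The abstract twisted Brin–Thompson groupoid, by generators and relations -/

/-- Formal composites of the generators: the elements of the Brin–Thompson groupoid, and the
tuples `(g_1, …, g_n) ∈ G^n`, based at `n`. `comp` is in the order of composition of functions. -/
inductive Word (G : Type u) (S : Type v) : ℕ → ℕ → Type (max u v)
  | homeo {m n : ℕ} (f : BT S m n) : Word G S m n
  | twist {n : ℕ} (g : Fin n → G) : Word G S n n
  | comp {l m n : ℕ} (b : Word G S m n) (a : Word G S l m) : Word G S l n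
  | inv {m n : ℕ} (a : Word G S m n) : Word G S n m

/-- Equality in the abstract twisted Brin–Thompson groupoid: the smallest congruence that contains
the groupoid laws, the multiplication of the Brin–Thompson groupoid and of the groups `G^n`, and
the two families of defining relations. -/
inductive Rel (G : Type u) (S : Type v) [Group G] [MulAction G S] :
    ∀ {m n : ℕ}, Word G S m n → Word G S m n → Prop
  | refl {m n : ℕ} (a : Word G S m n) : Rel G S a a
  | symm {m n : ℕ} {a b : Word G S m n} : Rel G S a b → Rel G S b a
  | trans {m n : ℕ} {a b c : Word G S m n} : Rel G S a b → Rel G S b c → Rel G S a c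
  | comp_congr {l m n : ℕ} {b b' : Word G S m n} {a a' : Word G S l m} :
      Rel G S b b' → Rel G S a a' → Rel G S (b.comp a) (b'.comp a')
  | inv_congr {m n : ℕ} {a a' : Word G S m n} : Rel G S a a' → Rel G S a.inv a'.inv
  | assoc {k l m n : ℕ} (c : Word G S m n) (b : Word G S l m) (a : Word G S k l) :
      Rel G S ((c.comp b).comp a) (c.comp (b.comp a))
  | id_comp {m n : ℕ} (a : Word G S m n) : Rel G S ((Word.homeo (BT.id S n)).comp a) a
  | comp_id {m n : ℕ} (a : Word G S m n) : Rel G S (a.comp (Word.homeo (BT.id S m))) a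
  | inv_comp {m n : ℕ} (a : Word G S m n) : Rel G S (a.inv.comp a) (Word.homeo (BT.id S m))
  | comp_inv {m n : ℕ} (a : Word G S m n) : Rel G S (a.comp a.inv) (Word.homeo (BT.id S n))
  /-- Composition of elements of the Brin–Thompson groupoid. -/
  | homeo_comp {l m n : ℕ} (f' : BT S m n) (f : BT S l m) :
      Rel G S ((Word.homeo f').comp (Word.homeo f)) (Word.homeo (f'.comp f))
  /-- Multiplication in `G^n`. -/
  | twist_mul {n : ℕ} (g g' : Fin n → G) :
      Rel G S ((Word.twist g).comp (Word.twist g')) (Word.twist (g * g'))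
  /-- The relation `x_{g.s} ∘ g = (g ⊕ g) ∘ x_s` for `g = g_k`, in direct sum with `g_i = g_i` on
  the other copies:
  `(1 ⊕ x_{g_k.s} ⊕ 1) ∘ (g_1, …, g_n) = (g_1, …, g_k, g_k, …, g_n) ∘ (1 ⊕ x_s ⊕ 1)`. -/
  | split {n : ℕ} (k : Fin n) (s : S) (g : Fin n → G) :
      Rel G S ((Word.homeo (BT.split k (g k • s))).comp (Word.twist g))
        ((Word.twist fun j => g (k.predAbove j)).comp (Word.homeo (BT.split k s)))
  /-- `(g_1 ⊕ ⋯ ⊕ g_n) ∘ p_σ = p_σ ∘ (g_{σ(1)} ⊕ ⋯ ⊕ g_{σ(n)})`. -/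
  | perm {n : ℕ} (σ : Equiv.Perm (Fin n)) (g : Fin n → G) :
      Rel G S ((Word.twist g).comp (Word.homeo (BT.perm S σ)))
        ((Word.homeo (BT.perm S σ)).comp (Word.twist fun i => g (σ i)))

/-- The congruence `Rel` as a setoid. -/
def wordSetoid (G : Type u) (S : Type v) [Group G] [MulAction G S] (m n : ℕ) :
    Setoid (Word G S m n) :=
  ⟨Rel G S, Rel.refl, Rel.symm, Rel.trans⟩

/-- The arrows from `m` to `n` in the abstract twisted Brin–Thompson groupoid. -/
def TwistedHom (G : Type u) (S : Type v) [Group G] [MulAction G S] (m n : ℕ) : Type (max u v) :=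
  Quotient (wordSetoid G S m n)

namespace TwistedHom

variable {G : Type u} {S : Type v} [Group G] [MulAction G S]

/-- The arrow represented by a word. -/
def mk {m n : ℕ} (a : Word G S m n) : TwistedHom G S m n := Quotient.mk (wordSetoid G S m n) a

/-- Composition of arrows. -/
def comp {l m n : ℕ} (b : TwistedHom G S m n) (a : TwistedHom G S l m) : TwistedHom G S l n :=
  Quotient.map₂ Word.comp (fun _ _ hb _ _ ha => Rel.comp_congr hb ha) b a

/-- Inverse of an arrow. -/
def inv {m n : ℕ} (a : TwistedHom G S m n) : TwistedHom G S n m :=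
  Quotient.map Word.inv (fun _ _ ha => Rel.inv_congr ha) a

/-- The arrows from `n` to `n` form a group under composition. -/
instance (n : ℕ) : Group (TwistedHom G S n n) where
  mul b a := comp b a
  one := mk (Word.homeo (BT.id S n))
  inv a := inv a
  mul_assoc := by
    rintro ⟨a⟩ ⟨b⟩ ⟨c⟩; exact Quotient.sound (Rel.assoc a b c)
  one_mul := by rintro ⟨a⟩; exact Quotient.sound (Rel.id_comp a)
  mul_one := by rintro ⟨a⟩; exact Quotient.sound (Rel.comp_id a)
  inv_mul_cancel := by rintro ⟨a⟩; exact Quotient.sound (Rel.inv_comp a)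

/-- The element `[F₋, σ, (g_1, …, g_n), F₊] = F₋⁻¹ ∘ p_σ ∘ (g_1, …, g_n) ∘ F₊`. -/
def quadruple {l m n : ℕ} (Fminus : BT S m n) (σ : Equiv.Perm (Fin n)) (g : Fin n → G)
    (Fplus : BT S l n) : TwistedHom G S l m :=
  (mk (Word.homeo Fminus)).inv.comp
    ((mk (Word.homeo (BT.perm S σ))).comp ((mk (Word.twist g)).comp (mk (Word.homeo Fplus))))

end TwistedHom

/-- The abstract twisted Brin–Thompson group `SV_G`. -/
abbrev SV (G : Type u) (S : Type v) [Group G] [MulAction G S] : Type (max u v) :=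
  TwistedHom G S 1 1

/-! ## Functoriality in the group, and the canonical kernel -/

/-- Apply a map to all the labels of a word. -/
def Word.map {G : Type u} {G' : Type w} {S : Type v} (φ : G → G') :
    ∀ {m n : ℕ}, Word G S m n → Word G' S m n
  | _, _, .homeo f => .homeo f
  | _, _, .twist g => .twist fun i => φ (g i)
  | _, _, .comp b a => .comp (b.map φ) (a.map φ)
  | _, _, .inv a => .inv (a.map φ)

theorem Rel.map {G : Type u} {G' : Type w} {S : Type v} [Group G] [MulAction G S] [Group G']
    [MulAction G' S] (φ : G →* G') (hφ : ∀ (g : G) (s : S), φ g • s = g • s) {m n : ℕ}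
    {a b : Word G S m n} (h : Rel G S a b) : Rel G' S (a.map φ) (b.map φ) := by
  induction h with
  | refl a => exact .refl _
  | symm _ ih => exact .symm ih
  | trans _ _ ih ih' => exact .trans ih ih'
  | comp_congr _ _ ih ih' => exact .comp_congr ih ih'
  | inv_congr _ ih => exact .inv_congr ih
  | assoc c b a => exact .assoc _ _ _
  | id_comp a => exact .id_comp _
  | comp_id a => exact .comp_id _
  | inv_comp a => exact .inv_comp _
  | comp_inv a => exact .comp_inv _
  | homeo_comp f' f => exact .homeo_comp _ _
  | twist_mul g g' =>
    have : (fun i => φ ((g * g') i)) = (fun i => φ (g i)) * fun i => φ (g' i) := by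
      funext i; simp
    simp only [Word.map, this]
    exact .twist_mul _ _
  | split k s g =>
    have := Rel.split (G := G') k s (fun i => φ (g i))
    rw [hφ] at this
    exact this
  | perm σ g => exact .perm _ _

/-- The homomorphism `SV_G → SV_{G'}` induced by a homomorphism `φ : G → G'` that is compatible
with the actions on `S`; it sends `[F₋, σ, (g_1, …, g_n), F₊]` to
`[F₋, σ, (φ g_1, …, φ g_n), F₊]`. -/
def SV.map {G : Type u} {G' : Type w} {S : Type v} [Group G] [MulAction G S] [Group G']
    [MulAction G' S] (φ : G →* G') (hφ : ∀ (g : G) (s : S), φ g • s = g • s) :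
    SV G S →* SV G' S :=
  MonoidHom.mk' (Quotient.map (Word.map φ) fun _ _ h => Rel.map φ hφ h) (by
    rintro ⟨a⟩ ⟨b⟩; rfl)

/-- The group `G / ker(G ↷ S)`. -/
def FaithfulQuotient (G : Type u) (S : Type v) [Group G] [MulAction G S] : Type u :=
  G ⧸ (MulAction.toPermHom G S).ker

instance (G : Type u) (S : Type v) [Group G] [MulAction G S] : Group (FaithfulQuotient G S) :=
  inferInstanceAs (Group (G ⧸ (MulAction.toPermHom G S).ker))

/-- The action of `G / ker(G ↷ S)` on `S` induced by the action of `G`. -/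
instance (G : Type u) (S : Type v) [Group G] [MulAction G S] :
    MulAction (FaithfulQuotient G S) S :=
  MulAction.compHom S (QuotientGroup.kerLift (MulAction.toPermHom G S))

/-- The quotient map `G → G / ker(G ↷ S)`. -/
def FaithfulQuotient.mk (G : Type u) (S : Type v) [Group G] [MulAction G S] :
    G →* FaithfulQuotient G S :=
  QuotientGroup.mk' (MulAction.toPermHom G S).ker

theorem FaithfulQuotient.mk_smul {G : Type u} {S : Type v} [Group G] [MulAction G S] (g : G)
    (s : S) : FaithfulQuotient.mk G S g • s = g • s := rfl

/-- The canonical kernel `SK_G`: the kernel of `SV_G → SV_{G / ker(G ↷ S)}`. -/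
def canonicalKernel (G : Type u) (S : Type v) [Group G] [MulAction G S] : Subgroup (SV G S) :=
  (SV.map (FaithfulQuotient.mk G S) FaithfulQuotient.mk_smul).ker

/-! ## Relative simplicity -/

/-- The pair `(H, N)`, with `N` a proper normal subgroup of `H`, is relatively simple: every proper
normal subgroup of `H` is contained in `N`. -/
def IsRelativelySimplePair {H : Type*} [Group H] (N : Subgroup H) : Prop :=
  N.Normal ∧ N ≠ ⊤ ∧ ∀ M : Subgroup H, M.Normal → M ≠ ⊤ → M ≤ N

/-- `H` is relatively simple. -/
def IsRelativelySimple (H : Type*) [Group H] : Prop :=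
  ∃ N : Subgroup H, IsRelativelySimplePair N

end BrinThompson

namespace BrinThompson

universe u v w

/-! ### Groupoid laws for the untwisted Brin–Thompson groupoid. -/

section BT
variable {S : Type v}

/-! The groupoid acts on the spaces `C^S(n)`, a label acting by permuting coordinates, and the
canonical kernel is exactly the kernel of the action of `SV_G` on `C^S(1)`. This comes from a normal
form. Every element of the untwisted groupoid is a fraction of two forests up to a permutation
(`BT.exists_isForest`), and the defining relations push labels and permutations through forests, so
every arrow `a` satisfies `F₋ ∘ a = μ ∘ F₊` with `μ` a labelled permutation (`exists_normalForm`).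
If the arrow acts trivially, comparing leaves forces the labels into the kernel of `G ↷ S` and `F₋ =
p_σ ∘ F₊` (`exists_eq_quadruple_of_eval_eq`).

Now let a normal subgroup `N` contain some `h` outside the kernel. Then `h` moves some brick off
itself. Take `α` and `β` exchanging small bricks inside it, `α` exchanging two siblings. The
conjugate of `α` by `h` commutes with `α` and `β`, so a double commutator puts `α⁻¹βαβ⁻¹`, a 3-cycle
of bricks, into `N` (`exists_alternatingGroup_le_permKer`).

It remains to see that such an `N` is everything, which is done in the quotient of the whole
groupoid by `N`. Refining bricks spreads the 3-cycle to all alternating groups, and then to all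
permutations, since a transposition becomes even once both copies are split (`permKer_eq_top`).
Without permutations, the position of a split is irrelevant; the relations between splits in two
directions make its direction irrelevant too (`redSplit_eq`). Then the relation between labels and
splits can be applied at two different positions, which kills the labels (`twistKer_eq_top`).
Finally all trees with equally many leaves coincide, so every normal form is trivial
(`eq_top_of_permKer_eq_top`). -/

@[ext]
theorem BT.ext {m n : ℕ} {f g : BT S m n} (h : ∀ p, f.homeo p = g.homeo p) : f = g := by
  cases f; cases g
  congr
  exact Homeomorph.ext h

theorem BT.ext_symm {m n : ℕ} {f g : BT S m n} (h : ∀ p, f.homeo.symm p = g.homeo.symm p) :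
    f = g := by
  ext p : 1
  rw [← f.homeo.symm.injective.eq_iff, h (g.homeo p)]
  simp

@[simp] theorem BT.comp_homeo {l m n : ℕ} (g : BT S m n) (f : BT S l m) (p : CantorPower S l) :
    (g.comp f).homeo p = g.homeo (f.homeo p) := rfl

@[simp] theorem BT.comp_homeo_symm {l m n : ℕ} (g : BT S m n) (f : BT S l m)
    (p : CantorPower S n) : (g.comp f).homeo.symm p = f.homeo.symm (g.homeo.symm p) := rfl

@[simp] theorem BT.inv_homeo {m n : ℕ} (f : BT S m n) : f.inv.homeo = f.homeo.symm := rfl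

@[simp] theorem BT.id_homeo {n : ℕ} (p : CantorPower S n) : (BT.id S n).homeo p = p := rfl

@[simp] theorem BT.perm_homeo {n : ℕ} (σ : Equiv.Perm (Fin n)) (p : CantorPower S n) :
    (BT.perm S σ).homeo p = (σ p.1, p.2) := rfl

@[simp] theorem BT.perm_homeo_symm {n : ℕ} (σ : Equiv.Perm (Fin n)) (p : CantorPower S n) :
    (BT.perm S σ).homeo.symm p = (σ.symm p.1, p.2) := rfl

theorem BT.comp_assoc {k l m n : ℕ} (h : BT S m n) (g : BT S l m) (f : BT S k l) :
    (h.comp g).comp f = h.comp (g.comp f) := rfl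

@[simp] theorem BT.id_comp {m n : ℕ} (f : BT S m n) : (BT.id S n).comp f = f := rfl

@[simp] theorem BT.comp_id {m n : ℕ} (f : BT S m n) : f.comp (BT.id S m) = f := rfl

@[simp] theorem BT.inv_comp {m n : ℕ} (f : BT S m n) : f.inv.comp f = BT.id S m := by
  ext p : 1; simp

@[simp] theorem BT.comp_inv {m n : ℕ} (f : BT S m n) : f.comp f.inv = BT.id S n := by
  ext p : 1; simp

theorem BT.perm_mul {n : ℕ} (σ τ : Equiv.Perm (Fin n)) :
    (BT.perm S σ).comp (BT.perm S τ) = BT.perm S (σ * τ) := rfl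

theorem BT.perm_one (n : ℕ) : BT.perm S (1 : Equiv.Perm (Fin n)) = BT.id S n := rfl

theorem BT.inv_perm {n : ℕ} (σ : Equiv.Perm (Fin n)) : (BT.perm S σ).inv = BT.perm S σ⁻¹ := rfl

/-! ### The leaves of a split -/

open Classical in
/-- Prefix a letter to the coordinate `s`. -/
noncomputable def cons (s : S) (b : Bool) (κ : S → ℕ → Bool) : S → ℕ → Bool :=
  Function.update κ s (prepend [b] (κ s))

theorem prepend_cons (b : Bool) (w : List Bool) (x : ℕ → Bool) :
    prepend (b :: w) x = prepend [b] (prepend w x) :=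
  prepend_append [b] w x

theorem cons_same (s : S) (b : Bool) (κ : S → ℕ → Bool) : cons s b κ s = prepend [b] (κ s) := by
  simp [cons]

theorem cons_of_ne {s t : S} (h : t ≠ s) (b : Bool) (κ : S → ℕ → Bool) : cons s b κ t = κ t := by
  simp [cons, h]

theorem cons_comm {s t : S} (h : s ≠ t) (b c : Bool) (κ : S → ℕ → Bool) :
    cons s b (cons t c κ) = cons t c (cons s b κ) := by
  funext r
  by_cases hs : r = s
  · subst hs; simp [cons, h]
  · by_cases ht : r = t
    · subst ht; simp [cons, hs]
    · simp [cons, hs, ht]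

theorem cons_injective {s : S} {b c : Bool} {κ κ' : S → ℕ → Bool}
    (h : cons s b κ = cons s c κ') : b = c ∧ κ = κ' := by
  have hs := congrFun h s
  rw [cons_same, cons_same] at hs
  have hb : b = c := by simpa [prepend] using congrFun hs 0
  subst hb
  refine ⟨rfl, funext fun t => ?_⟩
  by_cases ht : t = s
  · subst ht; exact prepend_injective _ hs
  · simpa [cons_of_ne ht] using congrFun h t

theorem exists_eq_cons (s : S) (κ : S → ℕ → Bool) : ∃ b κ', κ = cons s b κ' := by
  classical
  refine ⟨κ s 0, Function.update κ s (fun i => κ s (i + 1)), funext fun t => ?_⟩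
  by_cases h : t = s
  · subst h; simp [cons, prepend_singleton_eq]
  · simp [cons, h]

theorem BT.split_symm_castSucc {n : ℕ} (k : Fin n) (s : S) (κ : S → ℕ → Bool) :
    (BT.split k s).homeo.symm (k.castSucc, κ) = (k, cons s false κ) := by
  change (splitBrick k s k.castSucc).canon κ = _
  refine Prod.ext (by simp [splitBrick, Brick.canon]) (funext fun t => ?_)
  by_cases h : t = s
  · subst h; simp [splitBrick, Brick.canon, cons]
  · simp [splitBrick, Brick.canon, cons, h, prepend_nil]

theorem BT.split_symm_succ {n : ℕ} (k : Fin n) (s : S) (κ : S → ℕ → Bool) :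
    (BT.split k s).homeo.symm (k.succ, κ) = (k, cons s true κ) := by
  have hne : k.castSucc ≠ k.succ := (Fin.castSucc_lt_succ).ne
  change (splitBrick k s k.succ).canon κ = _
  refine Prod.ext (by simp [splitBrick, Brick.canon]) (funext fun t => ?_)
  by_cases h : t = s
  · subst h; simp [splitBrick, Brick.canon, cons, hne.symm]
  · simp [splitBrick, Brick.canon, cons, h, prepend_nil]

theorem BT.split_symm_of_predAbove_ne {n : ℕ} {k : Fin n} {j : Fin (n + 1)}
    (h : k.predAbove j ≠ k) (s : S) (κ : S → ℕ → Bool) :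
    (BT.split k s).homeo.symm (j, κ) = (k.predAbove j, κ) := by
  have h1 : j ≠ k.castSucc := by rintro rfl; simp at h
  have h2 : j ≠ k.succ := by rintro rfl; simp at h
  change (splitBrick k s j).canon κ = _
  refine Prod.ext (by simp [splitBrick, Brick.canon]) (funext fun t => ?_)
  simp [splitBrick, Brick.canon, h1, h2, prepend_nil]

/-- Copy `j` of the range of `f` corresponds canonically to the set of all `(i, w κ)`. -/
def BT.Leaf {m n : ℕ} (f : BT S m n) (j : Fin n) (i : Fin m)
    (w : (S → ℕ → Bool) → (S → ℕ → Bool)) : Prop :=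
  ∀ κ, f.homeo.symm (j, κ) = (i, w κ)

theorem BT.Leaf.comp {l m n : ℕ} {g : BT S m n} {f : BT S l m} {k : Fin n} {j : Fin m} {i : Fin l}
    {w w' : (S → ℕ → Bool) → (S → ℕ → Bool)} (hg : g.Leaf k j w) (hf : f.Leaf j i w') :
    (g.comp f).Leaf k i (w' ∘ w) := fun κ => by
  rw [BT.comp_homeo_symm, hg κ, hf]; rfl

theorem BT.Leaf.unique {m n : ℕ} {f : BT S m n} {j j' : Fin n} {i : Fin m}
    {w : (S → ℕ → Bool) → (S → ℕ → Bool)} (h : f.Leaf j i w) (h' : f.Leaf j' i w) : j = j' := by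
  have := (h fun _ _ => false).trans (h' fun _ _ => false).symm
  exact congrArg Prod.fst (f.homeo.symm.injective this)

theorem BT.leaf_split_castSucc {n : ℕ} (k : Fin n) (s : S) :
    (BT.split k s).Leaf k.castSucc k (cons s false) := BT.split_symm_castSucc k s

theorem BT.leaf_split_succ {n : ℕ} (k : Fin n) (s : S) :
    (BT.split k s).Leaf k.succ k (cons s true) := BT.split_symm_succ k s

theorem BT.exists_leaf_split {n : ℕ} (k : Fin n) (s : S) (b : Bool) :
    ∃ j, (BT.split k s).Leaf j k (cons s b) := by
  cases b
  exacts [⟨_, BT.leaf_split_castSucc k s⟩, ⟨_, BT.leaf_split_succ k s⟩]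

theorem BT.exists_leaf_split_of_ne {n : ℕ} {k i : Fin n} (h : i ≠ k) (s : S) :
    ∃ j, (BT.split k s).Leaf j i (fun κ => κ) := by
  obtain ⟨j, rfl⟩ := Fin.predAbove_surjective k i
  exact ⟨j, BT.split_symm_of_predAbove_ne h s⟩

theorem BT.leaf_split_cases {n : ℕ} (k : Fin n) (s : S) (j : Fin (n + 1)) :
    (∃ b, (BT.split k s).Leaf j k (cons s b)) ∨ ∃ i, i ≠ k ∧ (BT.split k s).Leaf j i (fun κ => κ) := by
  by_cases h : k.predAbove j = k
  · left
    rcases predAbove_eq_self h with rfl | rfl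
    exacts [⟨_, BT.leaf_split_castSucc k s⟩, ⟨_, BT.leaf_split_succ k s⟩]
  · exact .inr ⟨_, h, BT.split_symm_of_predAbove_ne h s⟩

theorem BT.Leaf.comp_perm {m n : ℕ} {f : BT S m n} {j : Fin n} {i : Fin m}
    {w : (S → ℕ → Bool) → (S → ℕ → Bool)} (h : f.Leaf j i w) (σ : Equiv.Perm (Fin m)) :
    (f.comp (BT.perm S σ)).Leaf j (σ.symm i) w := fun κ => by
  rw [BT.comp_homeo_symm, h κ]; rfl

/-- Two maps with the same leaves differ by a permutation. -/
theorem BT.exists_perm_comp {m n : ℕ} {f f' : BT S m n}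
    (h : ∀ j, ∃ j' i w, f.Leaf j i w ∧ f'.Leaf j' i w) :
    ∃ τ : Equiv.Perm (Fin n), f' = (BT.perm S τ).comp f := by
  choose τ i w h1 h2 using h
  have hinj : Function.Injective τ := by
    intro a b hab
    have h3 := h2 b
    rw [← hab] at h3
    have h4 : ∀ κ, (i a, w a κ) = (i b, w b κ) := fun κ => (h2 a κ).symm.trans (h3 κ)
    have h5 : f.Leaf a (i b) (w b) := fun κ => (h1 a κ).trans (h4 κ)
    exact h5.unique (h1 b)
  let e := Equiv.ofBijective τ (Finite.injective_iff_bijective.1 hinj)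
  refine ⟨e, BT.ext_symm ?_⟩
  rintro ⟨j, κ⟩
  obtain ⟨a, rfl⟩ := e.surjective j
  rw [BT.comp_homeo_symm, BT.perm_homeo_symm, Equiv.symm_apply_apply, h1 a κ]
  exact h2 a κ

/-- Both sides cut copy `k` in direction `s` and leave the other copies whole, so their leaves agree
and only the numbering can differ. -/
theorem BT.exists_perm_split {n : ℕ} (σ : Equiv.Perm (Fin n)) (k : Fin n) (s : S) :
    ∃ τ : Equiv.Perm (Fin (n + 1)),
      (BT.split (σ k) s).comp (BT.perm S σ) = (BT.perm S τ).comp (BT.split k s) := by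
  apply BT.exists_perm_comp
  intro j
  rcases BT.leaf_split_cases k s j with ⟨b, hb⟩ | ⟨i, hi, hj⟩
  · obtain ⟨j', hj'⟩ := BT.exists_leaf_split (σ k) s b
    exact ⟨j', k, _, hb, by simpa using hj'.comp_perm σ⟩
  · obtain ⟨j', hj'⟩ := BT.exists_leaf_split_of_ne (σ.injective.ne hi) s
    exact ⟨j', i, _, hj, by simpa using hj'.comp_perm σ⟩

/-! ### Forests -/

theorem IsForest.comp {l m n : ℕ} {E : BT S m n} {F : BT S l m} (hE : IsForest E)
    (hF : IsForest F) : IsForest (E.comp F) := by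
  induction hE with
  | id => simpa using hF
  | split E k s _ ih => rw [BT.comp_assoc]; exact .split _ k s ih

theorem isForest_split {n : ℕ} (k : Fin n) (s : S) : IsForest (BT.split k s) := by
  simpa using IsForest.split _ k s (IsForest.id n)

/-- The part of the canonical homeomorphism of a brick inside its copy. -/
def extend (w : S → List Bool) (κ : S → ℕ → Bool) : S → ℕ → Bool := fun s => prepend (w s) (κ s)

/-- A split appends one letter to the word of the leaf it cuts, so leaves of forests remain dyadic
bricks. -/
theorem IsForest.exists_leaf {m n : ℕ} {F : BT S m n} (hF : IsForest F) (j : Fin n) :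
    ∃ B : Brick S m, F.Leaf j B.copy (extend B.word) := by
  induction hF with
  | id => exact ⟨Brick.whole S j, fun κ =>
      Prod.ext rfl (funext fun s => (prepend_nil (κ s)).symm)⟩
  | split F k s _ ih =>
    classical
    rcases BT.leaf_split_cases k s j with ⟨b, hb⟩ | ⟨i, hi, hj⟩
    · obtain ⟨B, hB⟩ := ih k
      refine ⟨B.append (fun t => if t = s then [b] else [])
        ((Set.finite_singleton s).subset fun t ht => ?_), ?_⟩
      · by_contra hc
        exact ht (if_neg hc)
      · intro κ
        rw [hb.comp hB κ]
        refine Prod.ext rfl (funext fun t => ?_)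
        by_cases ht : t = s
        · subst ht; simp [extend, Brick.append, cons, prepend_append]
        · simp [extend, Brick.append, cons, ht]
    · obtain ⟨B, hB⟩ := ih i
      exact ⟨B, hj.comp hB⟩

theorem IsForest.exists_perm_comp {m n : ℕ} {F : BT S m n} (hF : IsForest F)
    (σ : Equiv.Perm (Fin m)) : ∃ (F' : BT S m n) (τ : Equiv.Perm (Fin n)), IsForest F' ∧
      F'.comp (BT.perm S σ) = (BT.perm S τ).comp F := by
  induction hF with
  | id => exact ⟨BT.id S _, σ, .id _, rfl⟩
  | split F k s _ ih =>
    obtain ⟨F', τ, hF', h⟩ := ih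
    obtain ⟨υ, hυ⟩ := BT.exists_perm_split τ k s
    refine ⟨_, υ, .split F' (τ k) s hF', ?_⟩
    rw [BT.comp_assoc, h, ← BT.comp_assoc, hυ, BT.comp_assoc]

end BT

section BT
variable {S : Type v}

/-! ### Elements of the groupoid as fractions of forests -/

theorem BT.Leaf.symm_eq {m n : ℕ} {f : BT S m n} {j : Fin n} {i : Fin m}
    {w : (S → ℕ → Bool) → (S → ℕ → Bool)} (h : f.Leaf j i w) (κ : S → ℕ → Bool) :
    f.homeo (i, w κ) = (j, κ) := by
  rw [← h κ, Homeomorph.apply_symm_apply]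

/-- Split in direction `s` the copies of `C^S` numbered by the elements of `J`. -/
theorem exists_isForest_split_finset (N : ℕ) (s : S) (J : Finset (Fin N)) :
    ∃ (M : ℕ) (E : BT S N M), IsForest E ∧ ∀ j,
      (∃ i ∉ J, E.Leaf j i (fun κ => κ)) ∨ ∃ i ∈ J, ∃ b, E.Leaf j i (cons s b) := by
  classical
  induction J using Finset.induction_on with
  | empty => exact ⟨N, BT.id S N, .id N, fun j => .inl ⟨j, by simp, fun κ => rfl⟩⟩
  | insert i₀ J hi₀ ih =>
    obtain ⟨M, E, hE, hleaf⟩ := ih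
    -- Since `i₀` is not in `J`, copy `i₀` is still uncut; its leaf is found by following an
    -- arbitrary point of it.
    obtain ⟨k, hk⟩ : ∃ k, E.Leaf k i₀ (fun κ => κ) := by
      let p := E.homeo (i₀, fun _ _ => false)
      have hp : E.homeo.symm (p.1, p.2) = (i₀, fun _ _ => false) := E.homeo.symm_apply_apply _
      refine ⟨p.1, ?_⟩
      rcases hleaf p.1 with ⟨i, -, h⟩ | ⟨i, hi, b, h⟩
      · have : i = i₀ := congrArg Prod.fst ((h p.2).symm.trans hp)
        exact this ▸ h
      · have : i = i₀ := congrArg Prod.fst ((h p.2).symm.trans hp)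
        exact absurd (this ▸ hi) hi₀
    refine ⟨M + 1, _, .split E k s hE, fun j => ?_⟩
    rcases BT.leaf_split_cases k s j with ⟨b, hb⟩ | ⟨l, hl, hj⟩
    · exact .inr ⟨i₀, by simp, b, hb.comp hk⟩
    · rcases hleaf l with ⟨i, hi, h⟩ | ⟨i, hi, b, h⟩
      · refine .inl ⟨i, ?_, hj.comp h⟩
        have : i ≠ i₀ := by
          rintro rfl
          exact hl (h.unique hk)
        simp [this, hi]
      · exact .inr ⟨i, by simp [hi], b, hj.comp h⟩

theorem extend_append (w w' : S → List Bool) (κ : S → ℕ → Bool) :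
    extend (fun s => w s ++ w' s) κ = extend w (extend w' κ) :=
  funext fun _ => prepend_append _ _ _

/-- A map that sends every copy of `C^S` canonically onto a dyadic brick becomes, after splitting
the range, a forest up to a permutation. -/
theorem exists_isForest_comp_eq (w : List S) : ∀ {N n : ℕ} (G : BT S N n) (c : Fin N → Fin n)
    (B : Fin N → S → List Bool), (∀ j κ, G.homeo (j, κ) = (c j, extend (B j) κ)) →
    (∀ [DecidableEq S] j s, (B j s).length ≤ w.count s) →
    ∃ (M : ℕ) (F : BT S n M) (E : BT S N M) (σ : Equiv.Perm (Fin M)), IsForest F ∧ IsForest E ∧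
      F.comp G = (BT.perm S σ).comp E := by
  classical
  induction w with
  | nil =>
    intro N n G c B hG hB
    -- The list `w` bounds, with multiplicity, the letters left in each direction. Once it is empty,
    -- whole copies go to whole copies and `G` is a permutation.
    have hB' : ∀ j, extend (B j) = fun κ => κ := by
      intro j
      funext κ s
      have : B j s = [] := List.eq_nil_of_length_eq_zero (by simpa using hB j s)
      simp [extend, this, prepend_nil]
    simp only [hB'] at hG
    have hc : Function.Bijective c := by
      constructor
      · intro i j hij
        have := G.homeo.injective ((hG i fun _ _ => false).trans
          (by rw [hij, hG j fun _ _ => false]))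
        exact congrArg Prod.fst this
      · intro i
        obtain ⟨⟨j, κ⟩, hj⟩ := G.homeo.surjective (i, fun _ _ => false)
        exact ⟨j, congrArg Prod.fst ((hG j κ).symm.trans hj)⟩
    obtain rfl : N = n := by simpa using Fintype.card_of_bijective hc
    refine ⟨N, BT.id S N, BT.id S N, Equiv.ofBijective c hc, .id N, .id N, ?_⟩
    ext ⟨j, κ⟩ : 1
    exact hG j κ
  | cons s w ih =>
    intro N n G c B hG hB
    -- Halve every copy of the range in direction `s`. A brick whose word at `s` is nonempty already
    -- lies in one half; the others are cut along with the range. After this each piece lies in one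
    -- half, and a word that was nonempty at `s` has lost its first letter.
    obtain ⟨n', F₁, hF₁, hl⟩ := exists_isForest_split_finset n s Finset.univ
    obtain ⟨N', E₁, hE₁, hm⟩ := exists_isForest_split_finset N s
      (Finset.univ.filter fun j => B j s = [])
    have hhalf : ∀ i b, ∃ i', F₁.Leaf i' i (cons s b) := by
      intro i b
      let p := F₁.homeo (i, cons s b fun _ _ => false)
      have hp : F₁.homeo.symm (p.1, p.2) = (i, cons s b fun _ _ => false) :=
        F₁.homeo.symm_apply_apply _
      refine ⟨p.1, ?_⟩
      rcases hl p.1 with ⟨i', hi', -⟩ | ⟨i', -, b', h⟩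
      · simp at hi'
      · have h3 := (h p.2).symm.trans hp
        obtain rfl : i' = i := congrArg Prod.fst h3
        obtain rfl := (cons_injective (congrArg Prod.snd h3)).1
        exact h
    have key : ∀ j, ∃ (i : Fin n) (b : Bool) (u : S → List Bool),
        (∀ t, (u t).length ≤ w.count t) ∧
        ∀ κ, (G.comp E₁.inv).homeo (j, κ) = (i, cons s b (extend u κ)) := by
      intro j
      rcases hm j with ⟨i, hi, h⟩ | ⟨i, hi, b, h⟩
      · obtain ⟨b, v, hv⟩ : ∃ b v, B i s = b :: v :=
          List.exists_cons_of_ne_nil (by simpa using hi)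
        refine ⟨c i, b, Function.update (B i) s v, fun t => ?_, fun κ => ?_⟩
        · have := hB i t
          by_cases ht : t = s
          · subst ht; simpa [hv] using this
          · simpa [ht, List.count_cons, Ne.symm ht] using this
        · rw [BT.comp_homeo, BT.inv_homeo, h κ, hG]
          refine Prod.ext rfl (funext fun t => ?_)
          by_cases ht : t = s
          · subst ht
            simp only [cons_same, extend, Function.update_self]
            rw [hv, prepend_cons]
          · simp [cons_of_ne ht, extend, ht]
      · have hi : B i s = [] := by simpa using hi
        refine ⟨c i, b, B i, fun t => ?_, fun κ => ?_⟩
        · have := hB i t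
          by_cases ht : t = s
          · subst ht; simp [hi]
          · simpa [List.count_cons, Ne.symm ht] using this
        · rw [BT.comp_homeo, BT.inv_homeo, h κ, hG]
          refine Prod.ext rfl (funext fun t => ?_)
          by_cases ht : t = s
          · subst ht; simp [cons_same, extend, hi, prepend_nil]
          · simp [cons_of_ne ht, extend]
    choose i b u hu hGE using key
    choose d hd using hhalf
    obtain ⟨M, F, E, σ, hF, hE, h⟩ := ih (F₁.comp (G.comp E₁.inv)) (fun j => d (i j) (b j)) u
      (fun j κ => by rw [BT.comp_homeo, hGE, (hd _ _).symm_eq])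
      (fun j t => by convert hu j t)
    refine ⟨M, F.comp F₁, E.comp E₁, σ, hF.comp hF₁, hE.comp hE₁, ?_⟩
    calc (F.comp F₁).comp G = (F.comp (F₁.comp (G.comp E₁.inv))).comp E₁ := by
          simp only [BT.comp_assoc, BT.inv_comp, BT.comp_id]
      _ = _ := by rw [h]; rfl

/-- The map that sends copy `i` canonically onto the `i`-th brick of a partition. -/
theorem IsPartition.exists_BT {m N : ℕ} {a : Fin N → Brick S m} (ha : IsPartition a) :
    ∃ G : BT S N m, ∀ i κ, G.homeo (i, κ) = (a i).canon κ := by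
  let e : CantorPower S N ≃ CantorPower S m :=
    Equiv.ofBijective (fun p => (a p.1).canon p.2) (by
      constructor
      · rintro ⟨j, κ⟩ ⟨j', κ'⟩ h
        have : j = j' := (ha ((a j).canon κ)).unique
          ((Brick.mem_carrier _ _).2 ⟨_, rfl⟩) ((Brick.mem_carrier _ _).2 ⟨_, h.symm⟩)
        subst this
        exact congrArg _ (Brick.canon_injective _ h)
      · intro p
        obtain ⟨j, hj, -⟩ := ha p
        obtain ⟨κ, hκ⟩ := (Brick.mem_carrier _ _).1 hj
        exact ⟨(j, κ), hκ⟩)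
  have he : Continuous e := continuous_prod_of_discrete_left.2 fun j => (a j).continuous_canon
  exact ⟨⟨he.homeoOfEquivCompactToT2, .mk _ (fun i => Brick.whole S i) a (isPartition_whole S N)
    fun i κ => by rw [Brick.whole_canon]; rfl⟩, fun i κ => rfl⟩

/-- Only finitely many directions occur; listing them all `L` times works, `L` being the total
length of all words. -/
theorem exists_count_le {N : ℕ} (B : Fin N → S → List Bool) (hB : ∀ j, {s | B j s ≠ []}.Finite) :
    ∃ w : List S, ∀ [DecidableEq S] j s, (B j s).length ≤ w.count s := by
  classical
  let D : Finset S := Finset.univ.biUnion fun j => (hB j).toFinset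
  let L : ℕ := ∑ j, ∑ s ∈ D, (B j s).length
  refine ⟨((List.replicate L D.toList).flatten), ?_⟩
  intro _ j s
  by_cases hs : B j s = []
  · simp [hs]
  have hsD : s ∈ D := by
    simp only [D, Finset.mem_biUnion, Finset.mem_univ, true_and]
    exact ⟨j, by simpa using hs⟩
  have h1 : (B j s).length ≤ L :=
    (Finset.single_le_sum (f := fun s => (B j s).length) (fun _ _ => Nat.zero_le _) hsD).trans
      (Finset.single_le_sum (f := fun j => ∑ s ∈ D, (B j s).length) (fun _ _ => Nat.zero_le _)
        (Finset.mem_univ j))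
  have h2 : 0 < D.toList.count s := List.count_pos_iff.2 (by simpa using hsD)
  rw [List.count_flatten, List.map_replicate, List.sum_replicate, smul_eq_mul]
  exact h1.trans (Nat.le_mul_of_pos_right L (by convert h2))

/-- Every element of the Brin–Thompson groupoid is `F₋⁻¹ ∘ p_σ ∘ F₊` for forests `F₋` and `F₊`. -/
theorem BT.exists_isForest {m n : ℕ} (f : BT S m n) :
    ∃ (N : ℕ) (Fm : BT S n N) (Fp : BT S m N) (σ : Equiv.Perm (Fin N)), IsForest Fm ∧ IsForest Fp ∧
      Fm.comp f = (BT.perm S σ).comp Fp := by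
  obtain ⟨N, a, b, ha, hb, hab⟩ := f.piecewise
  obtain ⟨A, hA⟩ := ha.exists_BT
  obtain ⟨w, hw⟩ := exists_count_le (fun j => (a j).word) fun j => (a j).finite
  obtain ⟨M, F, E, σ, hF, hE, h⟩ := exists_isForest_comp_eq w A _ _ hA hw
  -- `f ∘ F⁻¹ ∘ p_σ` sends every copy canonically onto a brick.
  have hfA : ∀ i κ, (f.comp A).homeo (i, κ) = (b i).canon κ := fun i κ => by
    rw [BT.comp_homeo, hA, hab]
  choose B hB using hE.exists_leaf
  have hG : ∀ j κ, ((f.comp A).comp E.inv).homeo (j, κ) =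
      ((b (B j).copy).copy, extend (fun s => (b (B j).copy).word s ++ (B j).word s) κ) := by
    intro j κ
    rw [BT.comp_homeo, BT.inv_homeo, hB j κ, hfA, extend_append]
    rfl
  obtain ⟨w', hw'⟩ := exists_count_le (fun j s => (b (B j).copy).word s ++ (B j).word s)
    fun j => ((b (B j).copy).append _ (B j).finite).finite
  obtain ⟨M', F', E', σ', hF', hE', h'⟩ := exists_isForest_comp_eq w' _ _ _ hG hw'
  -- The permutation `σ` stands between `E'` and `F`; moving it past `E'` leaves the composite of
  -- two forests `E'' ∘ F`.
  obtain ⟨E'', τ, hE'', h''⟩ := hE'.exists_perm_comp σ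
  refine ⟨M', F', E''.comp F, σ' * τ⁻¹, hF', hE''.comp hF, ?_⟩
  have hF_eq : F = (BT.perm S σ).comp (E.comp A.inv) := by
    rw [← BT.comp_assoc, ← h, BT.comp_assoc, BT.comp_inv, BT.comp_id]
  calc F'.comp f = (F'.comp ((f.comp A).comp E.inv)).comp (E.comp A.inv) := by
        have : E.inv.comp (E.comp A.inv) = A.inv := by
          rw [← BT.comp_assoc, BT.inv_comp, BT.id_comp]
        rw [BT.comp_assoc, BT.comp_assoc, this, BT.comp_assoc, BT.comp_inv, BT.comp_id]
    _ = (BT.perm S σ').comp (E'.comp (E.comp A.inv)) := by rw [h', BT.comp_assoc]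
    _ = (BT.perm S (σ' * τ⁻¹)).comp (((BT.perm S τ).comp E').comp (E.comp A.inv)) := by
        rw [BT.comp_assoc (BT.perm S τ), ← BT.comp_assoc _ (BT.perm S τ), BT.perm_mul,
          inv_mul_cancel_right]
    _ = _ := by rw [← h'', BT.comp_assoc, ← hF_eq]

end BT

namespace TwistedHom

variable {G : Type u} {S : Type v} [Group G] [MulAction G S]

/-! ### The groupoid laws -/

theorem comp_assoc {k l m n : ℕ} (c : TwistedHom G S m n) (b : TwistedHom G S l m)
    (a : TwistedHom G S k l) : (c.comp b).comp a = c.comp (b.comp a) := by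
  induction a, b using Quotient.inductionOn₂ with | _ a b
  induction c using Quotient.inductionOn with | _ c
  exact Quotient.sound (Rel.assoc c b a)

/-- The arrow given by an element of the Brin–Thompson groupoid. -/
def of {m n : ℕ} (f : BT S m n) : TwistedHom G S m n := mk (Word.homeo f)

/-- The arrow given by a tuple of labels. -/
def tw {n : ℕ} (g : Fin n → G) : TwistedHom G S n n := mk (Word.twist g)

@[simp] theorem id_comp {m n : ℕ} (a : TwistedHom G S m n) : (of (BT.id S n)).comp a = a := by
  induction a using Quotient.inductionOn with | _ a
  exact Quotient.sound (Rel.id_comp a)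

@[simp] theorem comp_id {m n : ℕ} (a : TwistedHom G S m n) : a.comp (of (BT.id S m)) = a := by
  induction a using Quotient.inductionOn with | _ a
  exact Quotient.sound (Rel.comp_id a)

@[simp] theorem inv_comp {m n : ℕ} (a : TwistedHom G S m n) :
    a.inv.comp a = of (BT.id S m) := by
  induction a using Quotient.inductionOn with | _ a
  exact Quotient.sound (Rel.inv_comp a)

@[simp] theorem comp_inv {m n : ℕ} (a : TwistedHom G S m n) :
    a.comp a.inv = of (BT.id S n) := by
  induction a using Quotient.inductionOn with | _ a
  exact Quotient.sound (Rel.comp_inv a)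

@[simp] theorem inv_comp_cancel_left {l m n : ℕ} (a : TwistedHom G S m n)
    (b : TwistedHom G S l m) : a.inv.comp (a.comp b) = b := by
  rw [← comp_assoc, inv_comp, id_comp]

@[simp] theorem comp_inv_cancel_left {l m n : ℕ} (a : TwistedHom G S m n)
    (b : TwistedHom G S l n) : a.comp (a.inv.comp b) = b := by
  rw [← comp_assoc, comp_inv, id_comp]

theorem comp_left_cancel {l m n : ℕ} {a : TwistedHom G S m n} {b c : TwistedHom G S l m}
    (h : a.comp b = a.comp c) : b = c := by
  rw [← inv_comp_cancel_left a b, h, inv_comp_cancel_left]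

theorem eq_inv_comp {l m n : ℕ} {a : TwistedHom G S m n} {b : TwistedHom G S l m}
    {c : TwistedHom G S l n} : b = a.inv.comp c ↔ a.comp b = c :=
  ⟨fun h => by rw [h, comp_inv_cancel_left], fun h => by rw [← h, inv_comp_cancel_left]⟩

@[simp] theorem inv_inv {m n : ℕ} (a : TwistedHom G S m n) : a.inv.inv = a := by
  apply comp_left_cancel (a := a.inv)
  rw [comp_inv, inv_comp]

@[simp] theorem comp_inv_rev {l m n : ℕ} (b : TwistedHom G S m n) (a : TwistedHom G S l m) :
    (b.comp a).inv = a.inv.comp b.inv := by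
  apply comp_left_cancel (a := b.comp a)
  rw [comp_inv, comp_assoc, comp_inv_cancel_left, comp_inv]

theorem of_comp {l m n : ℕ} (g : BT S m n) (f : BT S l m) :
    (of (g.comp f) : TwistedHom G S l n) = (of g).comp (of f) :=
  (Quotient.sound (Rel.homeo_comp g f)).symm

theorem of_inv {m n : ℕ} (f : BT S m n) : (of f.inv : TwistedHom G S n m) = (of f).inv := by
  apply comp_left_cancel (a := of f)
  rw [← of_comp, BT.comp_inv, comp_inv]

theorem tw_mul {n : ℕ} (g g' : Fin n → G) :
    (tw (g * g') : TwistedHom G S n n) = (tw g).comp (tw g') :=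
  (Quotient.sound (Rel.twist_mul g g')).symm

@[simp] theorem tw_one (n : ℕ) :
    (tw (1 : Fin n → G) : TwistedHom G S n n) = of (BT.id S n) := by
  apply comp_left_cancel (a := tw 1)
  rw [← tw_mul, mul_one, comp_id]

theorem tw_inv {n : ℕ} (g : Fin n → G) : (tw g⁻¹ : TwistedHom G S n n) = (tw g).inv := by
  apply comp_left_cancel (a := tw g)
  rw [← tw_mul, mul_inv_cancel, tw_one, comp_inv]

theorem split_tw {n : ℕ} (k : Fin n) (s : S) (g : Fin n → G) :
    (of (BT.split k (g k • s))).comp (tw g) =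
      (tw fun j => g (k.predAbove j)).comp (of (BT.split k s)) :=
  Quotient.sound (Rel.split k s g)

theorem tw_perm {n : ℕ} (σ : Equiv.Perm (Fin n)) (g : Fin n → G) :
    (tw g : TwistedHom G S n n).comp (of (BT.perm S σ)) =
      (of (BT.perm S σ)).comp (tw fun i => g (σ i)) :=
  Quotient.sound (Rel.perm σ g)

theorem mul_def {n : ℕ} (a b : TwistedHom G S n n) : a * b = a.comp b := rfl

theorem inv_def {n : ℕ} (a : TwistedHom G S n n) : a⁻¹ = a.inv := rfl

theorem quadruple_eq {l m n : ℕ} (Fm : BT S m n) (σ : Equiv.Perm (Fin n)) (g : Fin n → G)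
    (Fp : BT S l n) : quadruple Fm σ g Fp =
      (of Fm).inv.comp (((of (BT.perm S σ)).comp (tw g)).comp (of Fp)) := by
  rw [comp_assoc]; rfl

/-! ### Labelled permutations -/

/-- The arrows of the form `p_σ ∘ (g_1, …, g_n)`. -/
def IsMonomial {n : ℕ} (μ : TwistedHom G S n n) : Prop :=
  ∃ (σ : Equiv.Perm (Fin n)) (g : Fin n → G), μ = (of (BT.perm S σ)).comp (tw g)

theorem isMonomial_perm {n : ℕ} (σ : Equiv.Perm (Fin n)) :
    IsMonomial (of (BT.perm S σ) : TwistedHom G S n n) := ⟨σ, 1, by simp⟩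

theorem isMonomial_tw {n : ℕ} (g : Fin n → G) : IsMonomial (tw g : TwistedHom G S n n) :=
  ⟨1, g, by rw [BT.perm_one, id_comp]⟩

theorem IsMonomial.comp {n : ℕ} {μ ν : TwistedHom G S n n} (hμ : IsMonomial μ)
    (hν : IsMonomial ν) : IsMonomial (μ.comp ν) := by
  obtain ⟨σ, g, rfl⟩ := hμ
  obtain ⟨τ, h, rfl⟩ := hν
  refine ⟨σ * τ, (fun i => g (τ i)) * h, ?_⟩
  rw [comp_assoc, ← comp_assoc (tw g), tw_perm, comp_assoc, ← tw_mul, ← comp_assoc, ← of_comp,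
    BT.perm_mul]

theorem IsMonomial.inv {n : ℕ} {μ : TwistedHom G S n n} (hμ : IsMonomial μ) :
    IsMonomial μ.inv := by
  obtain ⟨σ, g, rfl⟩ := hμ
  rw [comp_inv_rev, ← tw_inv, ← of_inv, BT.inv_perm]
  exact (isMonomial_tw _).comp (isMonomial_perm _)

/-- The defining relation moves the split past the labels at the cost of replacing the direction `s`
by `g k • s`, and `BT.exists_perm_split` moves it past the permutation. -/
theorem exists_split_comp_isMonomial {n : ℕ} {μ : TwistedHom G S n n} (hμ : IsMonomial μ)
    (k : Fin n) (s : S) : ∃ (k' : Fin n) (s' : S) (μ' : TwistedHom G S (n + 1) (n + 1)),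
      IsMonomial μ' ∧ (of (BT.split k' s')).comp μ = μ'.comp (of (BT.split k s)) := by
  obtain ⟨σ, g, rfl⟩ := hμ
  obtain ⟨τ, hτ⟩ := BT.exists_perm_split σ k (g k • s)
  refine ⟨σ k, g k • s, _,
    (isMonomial_perm τ).comp (isMonomial_tw fun j => g (k.predAbove j)), ?_⟩
  rw [← comp_assoc, ← of_comp, hτ, of_comp, comp_assoc, split_tw, comp_assoc]

theorem exists_comp_isMonomial {m n : ℕ} {F : BT S m n} (hF : IsForest F)
    {μ : TwistedHom G S m m} (hμ : IsMonomial μ) :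
    ∃ (F' : BT S m n) (μ' : TwistedHom G S n n), IsForest F' ∧ IsMonomial μ' ∧
      (of F').comp μ = μ'.comp (of F) := by
  induction hF with
  | id => exact ⟨BT.id S _, μ, .id _, hμ, by simp⟩
  | split F k s _ ih =>
    obtain ⟨F', μ', hF', hμ', h⟩ := ih
    obtain ⟨k', s', ν, hν, h'⟩ := exists_split_comp_isMonomial hμ' k s
    refine ⟨_, ν, .split F' k' s' hF', hν, ?_⟩
    rw [of_comp, of_comp, comp_assoc, h, ← comp_assoc, h', comp_assoc]

/-- A normal form of an arrow: `F₋ ∘ a = μ ∘ F₊`. -/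
theorem exists_normalForm {m n : ℕ} (a : TwistedHom G S m n) :
    ∃ (N : ℕ) (Fm : BT S n N) (Fp : BT S m N) (μ : TwistedHom G S N N), IsForest Fm ∧
      IsForest Fp ∧ IsMonomial μ ∧ (of Fm).comp a = μ.comp (of Fp) := by
  induction a using Quotient.inductionOn with | _ a
  change ∃ (N : ℕ) (Fm : BT S n N) (Fp : BT S m N) (μ : TwistedHom G S N N), IsForest Fm ∧
      IsForest Fp ∧ IsMonomial μ ∧ (of Fm).comp (mk a) = μ.comp (of Fp)
  induction a with
  | homeo f =>
    obtain ⟨N, Fm, Fp, σ, hm, hp, h⟩ := f.exists_isForest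
    exact ⟨N, Fm, Fp, _, hm, hp, isMonomial_perm σ, by
      rw [← of_comp, ← h, of_comp]; rfl⟩
  | @twist n g => exact ⟨n, BT.id S n, BT.id S n, tw g, .id n, .id n, isMonomial_tw g, by
      rw [id_comp, comp_id]; rfl⟩
  | @comp l m n b a ihb iha =>
    obtain ⟨N, Fm, Fp, μ, hm, hp, hμ, h⟩ := iha
    obtain ⟨N', Fm', Fp', μ', hm', hp', hμ', h'⟩ := ihb
    -- The inner forests `Fp'` and `Fm` have the same roots. This is a common refinement `A ∘ Fp' =
    -- p_σ ∘ B ∘ Fm`; then `A` is pushed past `μ'` to the left and `B` past `μ⁻¹` to the right.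
    obtain ⟨M, A, B, σ, hA, hB, hAB⟩ := (Fp'.comp Fm.inv).exists_isForest
    obtain ⟨A', ν', hA', hν', e'⟩ := exists_comp_isMonomial hA hμ'
    obtain ⟨B', ν, hB', hν, e⟩ := exists_comp_isMonomial hB hμ.inv
    refine ⟨M, A'.comp Fm', B'.comp Fp, (ν'.comp (of (BT.perm S σ))).comp ν.inv, hA'.comp hm',
      hB'.comp hp, (hν'.comp (isMonomial_perm σ)).comp hν.inv, ?_⟩
    have ha : mk a = (of Fm).inv.comp (μ.comp (of Fp)) := eq_inv_comp.2 h
    have hb : ((of Fm').comp (mk b)) = μ'.comp (of Fp') := h'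
    have hAB' : (of A).comp ((of Fp').comp (of Fm).inv) =
        (of (BT.perm S σ) : TwistedHom G S M M).comp (of B) := by
      rw [← of_inv, ← of_comp, ← of_comp, ← of_comp, hAB]
    have e2 : ν.inv.comp (of B') = (of B).comp μ := by
      symm; rw [eq_inv_comp, ← comp_assoc, ← e, comp_assoc, inv_comp, comp_id]
    calc (of (A'.comp Fm')).comp (mk (b.comp a))
        = (of A').comp (((of Fm').comp (mk b)).comp (mk a)) := by
          rw [of_comp, comp_assoc, comp_assoc]; rfl
      _ = (((of A').comp μ').comp ((of Fp').comp (of Fm).inv)).comp (μ.comp (of Fp)) := by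
          rw [hb, ha]; simp only [comp_assoc]
      _ = ν'.comp (((of A).comp ((of Fp').comp (of Fm).inv)).comp (μ.comp (of Fp))) := by
          rw [e']; simp only [comp_assoc]
      _ = (ν'.comp (of (BT.perm S σ))).comp (((of B).comp μ).comp (of Fp)) := by
          rw [hAB']; simp only [comp_assoc]
      _ = _ := by
          rw [← e2, of_comp]; simp only [comp_assoc]
  | @inv m n a ih =>
    obtain ⟨N, Fm, Fp, μ, hm, hp, hμ, h⟩ := ih
    refine ⟨N, Fp, Fm, μ.inv, hp, hm, hμ.inv, ?_⟩
    change (of Fp).comp (mk a).inv = _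
    rw [eq_inv_comp, ← comp_assoc, ← h, comp_assoc, comp_inv, comp_id]

/-! ### The action on `C^S(n)` -/

/-- Permute the coordinates by `g`. -/
def permute (g : G) (κ : S → ℕ → Bool) : S → ℕ → Bool := fun s => κ (g⁻¹ • s)

theorem permute_mul (g h : G) (κ : S → ℕ → Bool) :
    permute (g * h) κ = permute g (permute h κ) := by
  funext s; simp [permute, mul_smul]

@[simp] theorem permute_one (κ : S → ℕ → Bool) : permute (1 : G) κ = κ := by
  funext s; simp [permute]

theorem permute_cons (g : G) (s : S) (b : Bool) (κ : S → ℕ → Bool) :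
    permute g (cons s b κ) = cons (g • s) b (permute g κ) := by
  funext t
  by_cases h : t = g • s
  · subst h; simp [permute, cons_same]
  · rw [cons_of_ne h, permute, cons_of_ne, permute]
    rwa [Ne, inv_smul_eq_iff]

/-- The homeomorphism of `C^S(n)` given by a tuple of labels. -/
def twistHomeo {n : ℕ} (g : Fin n → G) : CantorPower S n ≃ₜ CantorPower S n where
  toFun p := (p.1, permute (g p.1) p.2)
  invFun p := (p.1, permute (g p.1)⁻¹ p.2)
  left_inv p := by simp [← permute_mul]
  right_inv p := by simp [← permute_mul]
  continuous_toFun := continuous_prod_of_discrete_left.2 fun j =>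
    continuous_const.prodMk (continuous_pi fun s => continuous_apply ((g j)⁻¹ • s))
  continuous_invFun := continuous_prod_of_discrete_left.2 fun j =>
    continuous_const.prodMk (continuous_pi fun s => continuous_apply ((g j)⁻¹⁻¹ • s))

theorem twistHomeo_apply {n : ℕ} (g : Fin n → G) (i : Fin n) (κ : S → ℕ → Bool) :
    twistHomeo g (i, κ) = (i, permute (g i) κ) := rfl

end TwistedHom

open TwistedHom in
/-- The homeomorphism represented by a word. -/
def Word.eval {G : Type u} {S : Type v} [Group G] [MulAction G S] :
    ∀ {m n : ℕ}, Word G S m n → (CantorPower S m ≃ₜ CantorPower S n)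
  | _, _, .homeo f => f.homeo
  | _, _, .twist g => twistHomeo g
  | _, _, .comp b a => a.eval.trans b.eval
  | _, _, .inv a => a.eval.symm

/-- The action is well defined. The relation with content is `split`, checked leaf by leaf:
permuting coordinates by `g` carries a letter at `s` to the same letter at `g • s`. -/
theorem Rel.eval_eq {G : Type u} {S : Type v} [Group G] [MulAction G S] {m n : ℕ}
    {a b : Word G S m n} (h : Rel G S a b) (p : CantorPower S m) : a.eval p = b.eval p := by
  revert p
  induction h with
  | refl a => exact fun p => rfl
  | symm _ ih => exact fun p => (ih p).symm
  | trans _ _ ih ih' => exact fun p => (ih p).trans (ih' p)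
  | comp_congr _ _ ih ih' => exact fun p => by simp [Word.eval, ih, ih']
  | inv_congr _ ih =>
    intro p
    rw [Word.eval, Word.eval, Homeomorph.symm_apply_eq, ih, Homeomorph.apply_symm_apply]
  | assoc c b a => exact fun p => rfl
  | id_comp a => exact fun p => rfl
  | comp_id a => exact fun p => rfl
  | inv_comp a => exact fun p => by simp [Word.eval]
  | comp_inv a => exact fun p => by simp [Word.eval]
  | homeo_comp f' f => exact fun p => rfl
  | twist_mul g g' =>
    rintro ⟨i, κ⟩
    simp [Word.eval, TwistedHom.twistHomeo_apply, TwistedHom.permute_mul]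
  | split k s g =>
    intro p
    obtain ⟨⟨j, κ⟩, rfl⟩ := (BT.split k s).homeo.symm.surjective p
    simp only [Word.eval, Homeomorph.trans_apply, Homeomorph.apply_symm_apply,
      TwistedHom.twistHomeo_apply]
    rw [← Homeomorph.eq_symm_apply]
    by_cases h : k.predAbove j = k
    · rcases predAbove_eq_self h with rfl | rfl
      · rw [BT.split_symm_castSucc, BT.split_symm_castSucc, TwistedHom.twistHomeo_apply,
          TwistedHom.permute_cons, h]
      · rw [BT.split_symm_succ, BT.split_symm_succ, TwistedHom.twistHomeo_apply,
          TwistedHom.permute_cons, h]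
    · rw [BT.split_symm_of_predAbove_ne h, BT.split_symm_of_predAbove_ne h,
        TwistedHom.twistHomeo_apply]
  | perm σ g => exact fun p => rfl

namespace TwistedHom

variable {G : Type u} {S : Type v} [Group G] [MulAction G S]

/-- The homeomorphism represented by an arrow. -/
def eval {m n : ℕ} (a : TwistedHom G S m n) : CantorPower S m ≃ₜ CantorPower S n :=
  Quotient.lift Word.eval (fun _ _ h => Homeomorph.ext (Rel.eval_eq h)) a

@[simp] theorem eval_comp {l m n : ℕ} (b : TwistedHom G S m n) (a : TwistedHom G S l m)
    (p : CantorPower S l) : (b.comp a).eval p = b.eval (a.eval p) := by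
  induction a, b using Quotient.inductionOn₂ with | _ a b
  rfl

@[simp] theorem eval_of {m n : ℕ} (f : BT S m n) : (of f : TwistedHom G S m n).eval = f.homeo := rfl

@[simp] theorem eval_tw {n : ℕ} (g : Fin n → G) (i : Fin n) (κ : S → ℕ → Bool) :
    (tw g : TwistedHom G S n n).eval (i, κ) = (i, permute (g i) κ) := rfl

/-- If `g⁻¹ • s ≠ s`, changing `κ` at `s` alone changes the right side at coordinate `s` but not the
left. -/
theorem mem_ker_of_extend {w w' : S → List Bool} {g : G}
    (h : ∀ κ, extend w (permute g κ) = extend w' κ) : g ∈ (MulAction.toPermHom G S).ker := by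
  classical
  have key : ∀ s : S, g⁻¹ • s = s := by
    intro s
    by_contra hs
    have h1 := congrFun (h (Function.update (fun _ _ => false) s fun _ => true)) s
    have h2 := congrFun (h (fun _ _ => false)) s
    simp only [extend, permute, Function.update_self, Function.update_of_ne hs] at h1 h2
    have := congrFun (prepend_injective _ (h1.symm.trans h2)) 0
    simp at this
  rw [MonoidHom.mem_ker]
  ext s
  change g • s = s
  exact (inv_smul_eq_iff.1 (key s)).symm

theorem permute_of_mem_ker {g : G} (hg : g ∈ (MulAction.toPermHom G S).ker) (κ : S → ℕ → Bool) :
    permute g κ = κ := by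
  funext s
  have h : g⁻¹ • s = s := Equiv.Perm.congr_fun (MonoidHom.mem_ker.1 (inv_mem hg)) s
  rw [permute, h]

/-- An arrow that acts trivially on `C^S(n)` is conjugate by a forest to a tuple of elements of the
kernel of the action. -/
theorem exists_eq_quadruple_of_eval_eq {n : ℕ} (h : TwistedHom G S n n)
    (hh : ∀ p, h.eval p = p) : ∃ (N : ℕ) (F : BT S n N) (k : Fin N → G), IsForest F ∧
      (∀ i, k i ∈ (MulAction.toPermHom G S).ker) ∧ h = quadruple F 1 k F := by
  obtain ⟨N, Fm, Fp, -, hm, hp, ⟨σ, g, rfl⟩, e⟩ := exists_normalForm h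
  -- As `h` acts trivially, leaf `i` of `Fp` and leaf `σ i` of `Fm` are the same brick, with
  -- parametrizations differing by the label `g i`.
  have e1 : ∀ i κ, Fp.homeo.symm (i, κ) = Fm.homeo.symm (σ i, permute (g i) κ) := by
    intro i κ
    have := congrArg (fun a => a.eval (Fp.homeo.symm (i, κ))) e
    simp only [eval_comp, hh, eval_of, Homeomorph.apply_symm_apply, eval_tw,
      BT.perm_homeo] at this
    rw [← this, Homeomorph.symm_apply_apply]
  have hg : ∀ i, g i ∈ (MulAction.toPermHom G S).ker := by
    intro i
    obtain ⟨B, hB⟩ := hp.exists_leaf i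
    obtain ⟨B', hB'⟩ := hm.exists_leaf (σ i)
    refine mem_ker_of_extend (w := B'.word) (w' := B.word) fun κ => ?_
    have := e1 i κ
    rw [hB, hB'] at this
    exact (congrArg Prod.snd this).symm
  have hF : Fm = (BT.perm S σ).comp Fp := by
    apply BT.ext_symm
    rintro ⟨j, κ⟩
    obtain ⟨i, rfl⟩ := σ.surjective j
    have := e1 i κ
    rw [permute_of_mem_ker (hg i)] at this
    simp [this]
  refine ⟨N, Fp, g, hp, hg, ?_⟩
  rw [quadruple_eq, BT.perm_one, id_comp, eq_inv_comp]
  apply comp_left_cancel (a := of (BT.perm S σ))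
  rw [← comp_assoc, ← of_comp, ← hF, e, comp_assoc]

end TwistedHom

theorem Word.eval_map {G : Type u} {G' : Type w} {S : Type v} [Group G] [MulAction G S] [Group G']
    [MulAction G' S] (φ : G →* G') (hφ : ∀ (g : G) (s : S), φ g • s = g • s) {m n : ℕ}
    (a : Word G S m n) : (a.map φ).eval = a.eval := by
  induction a with
  | homeo f => rfl
  | twist g =>
    ext1 ⟨i, κ⟩
    refine Prod.ext rfl (funext fun s => ?_)
    change κ ((φ (g i))⁻¹ • s) = κ ((g i)⁻¹ • s)
    rw [← map_inv, hφ]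
  | comp b a ihb iha => simp only [Word.map, Word.eval, ihb, iha]
  | inv a ih => simp only [Word.map, Word.eval, ih]

/-! ### The canonical kernel is the kernel of the action. -/

section Kernel

variable {G : Type u} {S : Type v} [Group G] [MulAction G S]

open TwistedHom

theorem eval_eq_of_mem_canonicalKernel {h : SV G S} (hh : h ∈ canonicalKernel G S)
    (p : CantorPower S 1) : TwistedHom.eval h p = p := by
  induction h using Quotient.inductionOn with | _ a
  have h1 : TwistedHom.mk (a.map (FaithfulQuotient.mk G S)) = of (BT.id S 1) :=
    MonoidHom.mem_ker.1 hh
  have h2 := congrArg (fun b => TwistedHom.eval b p) h1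
  change (a.map (FaithfulQuotient.mk G S)).eval p = p at h2
  rwa [Word.eval_map _ FaithfulQuotient.mk_smul] at h2

theorem quadruple_mem_canonicalKernel {n : ℕ} (T : BT S 1 n) {k : Fin n → G}
    (hk : ∀ i, k i ∈ (MulAction.toPermHom G S).ker) :
    quadruple T 1 k T ∈ canonicalKernel G S := by
  have hk' : (fun i => FaithfulQuotient.mk G S (k i)) = 1 := by
    funext i
    exact (QuotientGroup.eq_one_iff (k i)).2 (hk i)
  refine MonoidHom.mem_ker.2 ?_
  change quadruple T 1 (fun i => FaithfulQuotient.mk G S (k i)) T = 1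
  rw [hk', quadruple_eq, BT.perm_one, id_comp, tw_one, id_comp, inv_comp]
  rfl

theorem mem_canonicalKernel_iff_eval {h : SV G S} :
    h ∈ canonicalKernel G S ↔ ∀ p, TwistedHom.eval h p = p := by
  refine ⟨eval_eq_of_mem_canonicalKernel, fun hh => ?_⟩
  obtain ⟨N, F, k, -, hk, rfl⟩ := exists_eq_quadruple_of_eval_eq h hh
  exact quadruple_mem_canonicalKernel F hk

theorem mem_canonicalKernel_iff {h : SV G S} : h ∈ canonicalKernel G S ↔
    ∃ (n : ℕ) (T : BT S 1 n) (k : Fin n → G), IsForest T ∧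
      (∀ i, k i ∈ (MulAction.toPermHom G S).ker) ∧ h = quadruple T 1 k T := by
  refine ⟨fun hh => exists_eq_quadruple_of_eval_eq h (eval_eq_of_mem_canonicalKernel hh), ?_⟩
  rintro ⟨n, T, k, -, hk, rfl⟩
  exact quadruple_mem_canonicalKernel T hk

/-- Exchanging the two halves of `C^S` in some direction moves points. -/
theorem canonicalKernel_ne_top [Nonempty S] : canonicalKernel G S ≠ ⊤ := by
  obtain ⟨s⟩ := ‹Nonempty S›
  intro htop
  let x := BT.split (0 : Fin 1) s
  let a : SV G S := of (x.inv.comp ((BT.perm S (Equiv.swap 0 1)).comp x))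
  have ha : a ∈ canonicalKernel G S := htop ▸ Subgroup.mem_top a
  have := eval_eq_of_mem_canonicalKernel ha (x.homeo.symm (0, fun _ _ => false))
  simp [a] at this

end Kernel

section Reduced

variable {G : Type u} {S : Type v} [Group G] [MulAction G S]

open TwistedHom

/-! ### The quotient of the groupoid by a normal subgroup of `SV_G` -/

/-- Two arrows are congruent modulo `N` if they differ by an arrow that is conjugate to an element
of `N`. -/
def arrowSetoid (N : Subgroup (SV G S)) (m n : ℕ) : Setoid (TwistedHom G S m n) where
  r a b := ∀ δ : TwistedHom G S 1 m, δ.inv.comp (a.inv.comp (b.comp δ)) ∈ N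
  iseqv := by
    refine ⟨fun a δ => ?_, fun {a b} h δ => ?_, fun {a b c} h h' δ => ?_⟩
    · rw [inv_comp_cancel_left, inv_comp]; exact N.one_mem
    · have := N.inv_mem (h δ)
      rw [TwistedHom.inv_def] at this
      simpa [TwistedHom.comp_assoc] using this
    · have := N.mul_mem (h δ) (h' δ)
      rw [TwistedHom.mul_def] at this
      simpa [TwistedHom.comp_assoc] using this

/-- Arrows modulo `N`. -/
def Reduced (N : Subgroup (SV G S)) (m n : ℕ) : Type (max u v) := Quotient (arrowSetoid N m n)

variable (N : Subgroup (SV G S))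

/-- The class of an arrow modulo `N`. -/
def red {m n : ℕ} (a : TwistedHom G S m n) : Reduced N m n := Quotient.mk (arrowSetoid N m n) a

variable {N}

theorem red_eq_red {m n : ℕ} {a b : TwistedHom G S m n} : red N a = red N b ↔
    ∀ δ : TwistedHom G S 1 m, δ.inv.comp (a.inv.comp (b.comp δ)) ∈ N :=
  Quotient.eq

theorem red_surjective {m n : ℕ} (x : Reduced N m n) : ∃ a, red N a = x := Quotient.exists_rep x

namespace Reduced

/-- Composition modulo `N`. -/
def comp {l m n : ℕ} (b : Reduced N m n) (a : Reduced N l m) : Reduced N l n :=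
  Quotient.map₂ TwistedHom.comp (fun b b' hb a a' ha δ => by
    have := N.mul_mem (hb (a.comp δ)) (ha δ)
    rw [TwistedHom.mul_def] at this
    simpa [TwistedHom.comp_assoc] using this) b a

end Reduced

theorem red_comp {l m n : ℕ} (b : TwistedHom G S m n) (a : TwistedHom G S l m) :
    red N (b.comp a) = (red N b).comp (red N a) := rfl

namespace Reduced

theorem comp_assoc {k l m n : ℕ} (c : Reduced N m n) (b : Reduced N l m) (a : Reduced N k l) :
    (c.comp b).comp a = c.comp (b.comp a) := by
  obtain ⟨a, rfl⟩ := red_surjective a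
  obtain ⟨b, rfl⟩ := red_surjective b
  obtain ⟨c, rfl⟩ := red_surjective c
  simp only [← red_comp, TwistedHom.comp_assoc]

@[simp] theorem id_comp {m n : ℕ} (a : Reduced N m n) :
    (red N (of (BT.id S n))).comp a = a := by
  obtain ⟨a, rfl⟩ := red_surjective a
  rw [← red_comp, TwistedHom.id_comp]

@[simp] theorem comp_id {m n : ℕ} (a : Reduced N m n) :
    a.comp (red N (of (BT.id S m))) = a := by
  obtain ⟨a, rfl⟩ := red_surjective a
  rw [← red_comp, TwistedHom.comp_id]

theorem comp_left_cancel {l m n : ℕ} {a : Reduced N m n} {b c : Reduced N l m}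
    (h : a.comp b = a.comp c) : b = c := by
  obtain ⟨a, rfl⟩ := red_surjective a
  have := congrArg (fun x => (red N a.inv).comp x) h
  simpa [← comp_assoc, ← red_comp] using this

theorem comp_right_cancel {l m n : ℕ} {a : Reduced N l m} {b c : Reduced N m n}
    (h : b.comp a = c.comp a) : b = c := by
  obtain ⟨a, rfl⟩ := red_surjective a
  have := congrArg (fun x => x.comp (red N a.inv)) h
  simpa [comp_assoc, ← red_comp] using this

end Reduced

theorem red_eq_id_iff_mem {a : SV G S} [hN : N.Normal] :
    red N a = red N (of (BT.id S 1)) ↔ a ∈ N := by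
  rw [eq_comm, red_eq_red]
  constructor
  · intro h
    have h1 := h (of (BT.id S 1))
    rw [← of_inv] at h1
    have h2 : (BT.id S 1).inv = BT.id S 1 := rfl
    simpa [h2, ← of_inv] using h1
  · intro h δ
    have h2 : (BT.id S 1).inv = BT.id S 1 := rfl
    have := hN.conj_mem a h δ⁻¹
    rw [_root_.inv_inv] at this
    rw [← of_inv, h2, TwistedHom.id_comp, ← TwistedHom.comp_assoc]
    exact this

/-- The congruence quantifies over all arrows `δ` from `1`; for normal `N` one of them is enough,
since `δ` is invertible in the quotient. -/
theorem red_eq_id_of_mem [hN : N.Normal] {n : ℕ} {α : TwistedHom G S n n}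
    {δ : TwistedHom G S 1 n} (h : δ.inv.comp (α.comp δ) ∈ N) :
    red N α = red N (of (BT.id S n)) := by
  have h1 := red_eq_id_iff_mem.2 h
  apply Reduced.comp_right_cancel (a := red N δ)
  apply Reduced.comp_left_cancel (a := red N δ.inv)
  simpa [← red_comp] using h1

/-! ### Permutations modulo `N` -/

variable (N) in
/-- The permutations that become trivial modulo `N`. -/
def permKer (n : ℕ) : Subgroup (Equiv.Perm (Fin n)) where
  carrier := {σ | red N (of (BT.perm S σ)) = red N (of (BT.id S n))}
  mul_mem' {σ τ} hσ hτ := by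
    rw [Set.mem_ofPred_eq] at hσ hτ ⊢
    rw [← BT.perm_mul, of_comp, red_comp, hσ, hτ, Reduced.id_comp]
  one_mem' := rfl
  inv_mem' {σ} hσ := by
    rw [Set.mem_ofPred_eq] at hσ ⊢
    apply Reduced.comp_left_cancel (a := red N (of (BT.perm S σ)))
    rw [← red_comp, ← of_comp, BT.perm_mul, mul_inv_cancel, BT.perm_one, hσ, Reduced.id_comp]

theorem mem_permKer {n : ℕ} {σ : Equiv.Perm (Fin n)} :
    σ ∈ permKer N n ↔ red N (of (BT.perm S σ)) = red N (of (BT.id S n)) := Iff.rfl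

instance permKer_normal (n : ℕ) : (permKer N n).Normal where
  conj_mem σ hσ τ := by
    rw [mem_permKer] at hσ ⊢
    rw [← BT.perm_mul, ← BT.perm_mul, of_comp, of_comp, red_comp, red_comp, hσ, Reduced.comp_id,
      ← red_comp, ← of_comp, BT.perm_mul, mul_inv_cancel, BT.perm_one]

/-- Here `τ` is the conjugate of `σ` by `f`. This transports triviality between different numbers of
copies. -/
theorem mem_permKer_iff_of_comp_eq {m n : ℕ} {f : BT S m n} {σ : Equiv.Perm (Fin m)}
    {τ : Equiv.Perm (Fin n)} (h : f.comp (BT.perm S σ) = (BT.perm S τ).comp f) :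
    σ ∈ permKer N m ↔ τ ∈ permKer N n := by
  have h' := congrArg (fun f => red N (of f)) h
  simp only [of_comp, red_comp] at h'
  rw [mem_permKer, mem_permKer]
  constructor
  · intro hσ
    rw [hσ, Reduced.comp_id] at h'
    apply Reduced.comp_right_cancel (a := red N (of f))
    rw [← h', Reduced.id_comp]
  · intro hτ
    rw [hτ, Reduced.id_comp] at h'
    apply Reduced.comp_left_cancel (a := red N (of f))
    rw [h', Reduced.comp_id]

/-- Exchanging two copies amounts to exchanging corresponding leaves inside them. -/
theorem BT.comp_perm_swap {m n : ℕ} {f : BT S m n} {a b : Fin m} {ι : Type*} {α β : ι → Fin n}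
    {w : ι → (S → ℕ → Bool) → (S → ℕ → Bool)} (hα : ∀ c, f.Leaf (α c) a (w c))
    (hβ : ∀ c, f.Leaf (β c) b (w c)) (hw : ∀ κ, ∃ c κ', κ = w c κ') {τ : Equiv.Perm (Fin n)}
    (hτα : ∀ c, τ (α c) = β c) (hτβ : ∀ c, τ (β c) = α c)
    (hτ : ∀ j, (∀ c, j ≠ α c ∧ j ≠ β c) → τ j = j) :
    f.comp (BT.perm S (Equiv.swap a b)) = (BT.perm S τ).comp f := by
  have hinj : ∀ {j i i' κ κ'}, f.Leaf i i' κ' → f.homeo.symm (j, κ) = (i', κ' κ) → j = i := by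
    intro j i i' κ κ' h h'
    exact congrArg Prod.fst (f.homeo.symm.injective (h'.trans (h κ).symm))
  apply BT.ext_symm
  rintro ⟨j, κ⟩
  obtain ⟨j, rfl⟩ := τ.surjective j
  simp only [BT.comp_homeo_symm, BT.perm_homeo_symm, Equiv.symm_apply_apply, Equiv.symm_swap]
  by_cases h : ∃ c, j = α c ∨ j = β c
  · obtain ⟨c, rfl | rfl⟩ := h
    · rw [hτα, hα c κ, hβ c κ, Equiv.swap_apply_right]
    · rw [hτβ, hα c κ, hβ c κ, Equiv.swap_apply_left]
  · push Not at h
    rw [hτ j h]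
    rcases hp : f.homeo.symm (j, κ) with ⟨i, κ₁⟩
    have key : ∀ {i' : Fin m} {γ : ι → Fin n}, (∀ c, f.Leaf (γ c) i' (w c)) →
        (∀ c, j ≠ γ c) → i ≠ i' := by
      rintro i' γ hγ hne rfl
      obtain ⟨c, κ', rfl⟩ := hw κ₁
      exact hne c (congrArg Prod.fst (f.homeo.symm.injective (hp.trans (hγ c κ').symm)))
    rw [Equiv.swap_apply_of_ne_of_ne (key hα fun c => (h c).1) (key hβ fun c => (h c).2)]

theorem BT.split_comp_perm_swap {n : ℕ} {k a b : Fin n} {s : S} {a' b' : Fin (n + 1)}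
    (ha : (BT.split k s).Leaf a' a (fun κ => κ)) (hb : (BT.split k s).Leaf b' b (fun κ => κ)) :
    (BT.split k s).comp (BT.perm S (Equiv.swap a b)) =
      (BT.perm S (Equiv.swap a' b')).comp (BT.split k s) :=
  BT.comp_perm_swap (ι := Unit) (α := fun _ => a') (β := fun _ => b') (fun _ => ha) (fun _ => hb)
    (fun κ => ⟨(), κ, rfl⟩) (fun _ => Equiv.swap_apply_left _ _)
    (fun _ => Equiv.swap_apply_right _ _)
    (fun _ h => Equiv.swap_apply_of_ne_of_ne (h ()).1 (h ()).2)

theorem BT.Leaf.ne {m n : ℕ} {f : BT S m n} {j j' : Fin n} {i i' : Fin m}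
    {w w' : (S → ℕ → Bool) → (S → ℕ → Bool)} (h : f.Leaf j i w) (h' : f.Leaf j' i' w')
    (hi : i ≠ i') : j ≠ j' := by
  rintro rfl
  exact hi (congrArg Prod.fst ((h fun _ _ => false).symm.trans (h' fun _ _ => false)))

/-- The product is a 3-cycle; all 3-cycles are conjugate in the symmetric group and generate the
alternating group. -/
theorem alternatingGroup_le_of_mem {n : ℕ} {H : Subgroup (Equiv.Perm (Fin n))} [hH : H.Normal]
    {a b c : Fin n} (hab : a ≠ b) (hac : a ≠ c) (hbc : b ≠ c)
    (h : Equiv.swap a b * Equiv.swap a c ∈ H) : alternatingGroup (Fin n) ≤ H := by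
  rw [← Equiv.Perm.closure_three_cycles_eq_alternating, Subgroup.closure_le]
  intro σ hσ
  have h3 := Equiv.Perm.isThreeCycle_swap_mul_swap_same hab hac hbc
  have hconj : IsConj (Equiv.swap a b * Equiv.swap a c) σ :=
    Equiv.Perm.isConj_iff_cycleType_eq.2 (h3.trans (Eq.symm hσ))
  obtain ⟨τ, rfl⟩ := isConj_iff.1 hconj
  exact hH.conj_mem _ h τ

theorem swap_mul_swap_mem_alternatingGroup {n : ℕ} {a b c d : Fin n} (hab : a ≠ b) (hcd : c ≠ d) :
    Equiv.swap a b * Equiv.swap c d ∈ alternatingGroup (Fin n) := by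
  rw [Equiv.Perm.mem_alternatingGroup, Equiv.Perm.sign_mul, Equiv.Perm.sign_swap hab,
    Equiv.Perm.sign_swap hcd]
  rfl

theorem exists_distinct {n : ℕ} (hn : 4 ≤ n) :
    ∃ a b c d : Fin n, a ≠ b ∧ a ≠ c ∧ b ≠ c ∧ a ≠ d ∧ b ≠ d ∧ c ≠ d :=
  ⟨⟨0, by omega⟩, ⟨1, by omega⟩, ⟨2, by omega⟩, ⟨3, by omega⟩, by simp⟩

/-- A 3-cycle on three copies is again a 3-cycle after splitting a fourth copy, which `4 ≤ n`
provides. -/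
theorem alternatingGroup_le_permKer_succ_iff [Nonempty S] {n : ℕ} (hn : 4 ≤ n) :
    alternatingGroup (Fin n) ≤ permKer N n ↔
      alternatingGroup (Fin (n + 1)) ≤ permKer N (n + 1) := by
  obtain ⟨s⟩ := ‹Nonempty S›
  obtain ⟨a, b, c, d, hab, hac, hbc, had, hbd, hcd⟩ := exists_distinct hn
  obtain ⟨a', ha⟩ := BT.exists_leaf_split_of_ne had s
  obtain ⟨b', hb⟩ := BT.exists_leaf_split_of_ne hbd s
  obtain ⟨c', hc⟩ := BT.exists_leaf_split_of_ne hcd s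
  have e : (BT.split d s).comp (BT.perm S (Equiv.swap a b * Equiv.swap a c)) =
      (BT.perm S (Equiv.swap a' b' * Equiv.swap a' c')).comp (BT.split d s) := by
    rw [← BT.perm_mul, ← BT.comp_assoc, BT.split_comp_perm_swap ha hb, BT.comp_assoc,
      BT.split_comp_perm_swap ha hc, ← BT.comp_assoc, BT.perm_mul]
  have key := mem_permKer_iff_of_comp_eq (N := N) e
  exact ⟨fun h => alternatingGroup_le_of_mem (ha.ne hb hab) (ha.ne hc hac) (hb.ne hc hbc)
      (key.1 (h (swap_mul_swap_mem_alternatingGroup hab hac))),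
    fun h => alternatingGroup_le_of_mem hab hac hbc
      (key.2 (h (swap_mul_swap_mem_alternatingGroup (ha.ne hb hab) (ha.ne hc hac))))⟩

theorem alternatingGroup_le_permKer [Nonempty S] {n₀ : ℕ} (hn₀ : 4 ≤ n₀)
    (h : alternatingGroup (Fin n₀) ≤ permKer N n₀) {n : ℕ} (hn : 4 ≤ n) :
    alternatingGroup (Fin n) ≤ permKer N n := by
  have key : ∀ n, 4 ≤ n →
      (alternatingGroup (Fin 4) ≤ permKer N 4 ↔ alternatingGroup (Fin n) ≤ permKer N n) := by
    intro n hn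
    induction n, hn using Nat.le_induction with
    | base => rfl
    | succ n hn ih => rw [ih, alternatingGroup_le_permKer_succ_iff hn]
  exact (key n hn).1 ((key n₀ hn₀).2 h)

/-- Splitting both copies that are exchanged by a transposition turns it into an even permutation. -/
theorem permKer_eq_top [Nonempty S] {n₀ : ℕ} (hn₀ : 4 ≤ n₀)
    (h : alternatingGroup (Fin n₀) ≤ permKer N n₀) (n : ℕ) : permKer N n = ⊤ := by
  obtain ⟨s⟩ := ‹Nonempty S›
  rw [eq_top_iff, ← Equiv.Perm.closure_isSwap, Subgroup.closure_le]
  rintro _ ⟨a, b, hab, rfl⟩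
  -- A transposition needs two copies, so the two splits below lead to `n + 2 ≥ 4` copies.
  have hn : 2 ≤ n := by
    have := a.2; have := b.2
    have : (a : ℕ) ≠ b := fun h => hab (Fin.ext h)
    omega
  obtain ⟨b₁, hb₁⟩ := BT.exists_leaf_split_of_ne hab.symm s
  choose e he using BT.exists_leaf_split a s
  have heb : ∀ c, e c ≠ b₁ := fun c => (he c).ne hb₁ hab
  choose α hα using fun c => BT.exists_leaf_split_of_ne (heb c) s
  choose β hβ using BT.exists_leaf_split b₁ s
  have hα' : ∀ c, ((BT.split b₁ s).comp (BT.split a s)).Leaf (α c) a (cons s c) :=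
    fun c => (hα c).comp (he c)
  have hβ' : ∀ c, ((BT.split b₁ s).comp (BT.split a s)).Leaf (β c) b (cons s c) :=
    fun c => (hβ c).comp hb₁
  have hαβ : ∀ c d, α c ≠ β d := fun c d => (hα' c).ne (hβ' d) hab
  have hαα : α false ≠ α true := by
    intro hc
    have := hα' false fun _ _ => false
    rw [hc, hα' true] at this
    exact absurd (cons_injective (congrArg Prod.snd this)).1 (by simp)
  have hββ : β false ≠ β true := by
    intro hc
    have := hβ' false fun _ _ => false
    rw [hc, hβ' true] at this
    exact absurd (cons_injective (congrArg Prod.snd this)).1 (by simp)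
  have hcomp := BT.comp_perm_swap hα' hβ' (fun κ => exists_eq_cons s κ)
    (τ := Equiv.swap (α false) (β false) * Equiv.swap (α true) (β true))
    (by
      rintro (_ | _)
      · rw [Equiv.Perm.mul_apply, Equiv.swap_apply_of_ne_of_ne hαα (hαβ _ _),
          Equiv.swap_apply_left]
      · rw [Equiv.Perm.mul_apply, Equiv.swap_apply_left,
          Equiv.swap_apply_of_ne_of_ne (hαβ _ _).symm hββ.symm])
    (by
      rintro (_ | _)
      · rw [Equiv.Perm.mul_apply, Equiv.swap_apply_of_ne_of_ne (hαβ _ _).symm hββ,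
          Equiv.swap_apply_right]
      · rw [Equiv.Perm.mul_apply, Equiv.swap_apply_right,
          Equiv.swap_apply_of_ne_of_ne hαα.symm (hαβ _ _)])
    (fun j hj => by
      rw [Equiv.Perm.mul_apply, Equiv.swap_apply_of_ne_of_ne (hj true).1 (hj true).2,
        Equiv.swap_apply_of_ne_of_ne (hj false).1 (hj false).2])
  rw [SetLike.mem_coe, mem_permKer_iff_of_comp_eq hcomp]
  exact alternatingGroup_le_permKer hn₀ h (by omega)
    (swap_mul_swap_mem_alternatingGroup (hαβ _ _) (hαβ _ _))

end Reduced

section Refine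
variable {S : Type v}

open Filter Topology

/-! ### Forests with small leaves -/

/-- The sets that contain the leaf of `p` in a suitable refinement of every forest. -/
def leafFilter {m : ℕ} (p : CantorPower S m) : Filter (CantorPower S m) where
  sets := {W | ∀ (n : ℕ) (F : BT S m n), IsForest F → ∃ (M : ℕ) (C : BT S n M), IsForest C ∧
    ∀ κ, (C.comp F).homeo.symm (((C.comp F).homeo p).1, κ) ∈ W}
  univ_sets n F _ := ⟨n, BT.id S n, .id n, fun _ => Set.mem_univ _⟩
  sets_of_superset hW hWV n F hF := by
    obtain ⟨M, C, hC, h⟩ := hW n F hF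
    exact ⟨M, C, hC, fun κ => hWV (h κ)⟩
  inter_sets hV hW n F hF := by
    obtain ⟨M, C, hC, h⟩ := hV n F hF
    -- Refining further keeps what `C` achieved: the leaf of `p` only shrinks.
    obtain ⟨M', C', hC', h'⟩ := hW M _ (hC.comp hF)
    refine ⟨M', C'.comp C, hC'.comp hC, fun κ => ⟨?_, h' κ⟩⟩
    rw [BT.comp_assoc]
    set E := C.comp F
    obtain ⟨B, hB⟩ := hC'.exists_leaf (C'.homeo (E.homeo p)).1
    have h1 : B.copy = (E.homeo p).1 := by
      have := hB (C'.homeo (E.homeo p)).2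
      rw [Prod.mk.eta, Homeomorph.symm_apply_apply] at this
      exact (congrArg Prod.fst this).symm
    have := h (extend B.word κ)
    rwa [← h1, ← hB κ] at this

/-- Keep splitting the leaf of `p` in direction `s`; each split adds a letter to its word there. -/
theorem IsForest.exists_long_leaf {m n : ℕ} {F : BT S m n} (hF : IsForest F) (p : CantorPower S m)
    (s : S) (r : ℕ) : ∃ (M : ℕ) (C : BT S n M) (i : Fin m) (w : S → List Bool), IsForest C ∧
      (C.comp F).Leaf ((C.comp F).homeo p).1 i (extend w) ∧ r ≤ (w s).length := by
  classical
  induction r with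
  | zero =>
    obtain ⟨B, hB⟩ := hF.exists_leaf (F.homeo p).1
    exact ⟨n, BT.id S n, B.copy, B.word, .id n, hB, Nat.zero_le _⟩
  | succ r ih =>
    obtain ⟨M, C, i, w, hC, hl, hr⟩ := ih
    set E := C.comp F with hE
    obtain ⟨b, κ, hκ⟩ := exists_eq_cons s (E.homeo p).2
    obtain ⟨j, hj⟩ := BT.exists_leaf_split (E.homeo p).1 s b
    refine ⟨M + 1, _, i, Function.update w s (w s ++ [b]), .split C (E.homeo p).1 s hC, ?_, ?_⟩
    · have hp : (((BT.split (E.homeo p).1 s).comp E).homeo p).1 = j := by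
        have h2 : E.homeo p = ((E.homeo p).1, cons s b κ) := Prod.ext rfl hκ
        have h3 := hj.symm_eq κ
        rw [← h2] at h3
        rw [BT.comp_homeo, h3]
      rw [BT.comp_assoc, ← hE, hp]
      intro κ'
      rw [hj.comp hl κ']
      refine Prod.ext rfl (funext fun t => ?_)
      by_cases ht : t = s
      · subst ht; simp [extend, cons_same, prepend_append]
      · simp [extend, cons_of_ne ht, ht]
    · simpa using hr

/-- The filter formulation reduces the product topology to one letter of one coordinate at a time. A
leaf with at least `i + 1` letters in direction `s` fixes letter `i` of that coordinate. -/
theorem leafFilter_le_nhds {m : ℕ} (p : CantorPower S m) : leafFilter p ≤ 𝓝 p := by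
  have h1 : Tendsto Prod.fst (leafFilter p) (𝓝 p.1) := by
    rw [nhds_discrete, tendsto_pure]
    intro n F hF
    refine ⟨n, BT.id S n, .id n, fun κ => ?_⟩
    rw [BT.id_comp]
    obtain ⟨B, hB⟩ := hF.exists_leaf (F.homeo p).1
    have h2 := hB (F.homeo p).2
    rw [Prod.mk.eta, Homeomorph.symm_apply_apply] at h2
    rw [hB κ, h2]
    rfl
  have h2 : Tendsto Prod.snd (leafFilter p) (𝓝 p.2) := by
    rw [tendsto_pi_nhds]
    intro s
    rw [tendsto_pi_nhds]
    intro i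
    rw [nhds_discrete, tendsto_pure]
    intro n F hF
    obtain ⟨M, C, c, w, hC, hl, hr⟩ := hF.exists_long_leaf p s (i + 1)
    refine ⟨M, C, hC, fun κ => ?_⟩
    have h3 := hl ((C.comp F).homeo p).2
    rw [Prod.mk.eta, Homeomorph.symm_apply_apply] at h3
    have hi : i < (w s).length := hr
    rw [hl κ, h3]
    change prepend _ _ i = prepend _ _ i
    simp [prepend, hi]
  have := h1.prodMk_nhds h2
  exact tendsto_id'.1 this

/-- A forest can be refined to have a small leaf at a given point. -/
theorem IsForest.exists_leaf_subset {m n : ℕ} {F : BT S m n} (hF : IsForest F)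
    (p : CantorPower S m) {W : Set (CantorPower S m)} (hW : W ∈ 𝓝 p) :
    ∃ (M : ℕ) (C : BT S n M), IsForest C ∧
      ∀ q, ((C.comp F).homeo q).1 = ((C.comp F).homeo p).1 → q ∈ W := by
  obtain ⟨M, C, hC, h⟩ := leafFilter_le_nhds p hW n F hF
  refine ⟨M, C, hC, fun q hq => ?_⟩
  have := h ((C.comp F).homeo q).2
  rwa [← hq, Prod.mk.eta, Homeomorph.symm_apply_apply] at this

/-! ### Conjugates of permutations -/

/-- The permutation `σ` of the leaves of `f`. -/
def BT.permLeaves {m n : ℕ} (f : BT S m n) (σ : Equiv.Perm (Fin n)) : BT S m m :=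
  f.inv.comp ((BT.perm S σ).comp f)

theorem BT.permLeaves_homeo {m n : ℕ} (f : BT S m n) (σ : Equiv.Perm (Fin n))
    (q : CantorPower S m) : (f.permLeaves σ).homeo q =
      f.homeo.symm (σ (f.homeo q).1, (f.homeo q).2) := rfl

theorem BT.comp_permLeaves_comp {l m n : ℕ} (g : BT S m n) (f : BT S l m)
    (σ : Equiv.Perm (Fin n)) :
    f.comp ((g.comp f).permLeaves σ) = (g.permLeaves σ).comp f := by
  ext q : 1
  simp [BT.permLeaves_homeo]

theorem BT.permLeaves_mul {m n : ℕ} (f : BT S m n) (σ τ : Equiv.Perm (Fin n)) :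
    (f.permLeaves σ).comp (f.permLeaves τ) = f.permLeaves (σ * τ) := by
  ext q : 1
  simp [BT.permLeaves_homeo]

theorem BT.permLeaves_comp_inv {m n : ℕ} (f : BT S m n) (σ : Equiv.Perm (Fin n)) :
    (f.permLeaves σ).comp (f.permLeaves σ⁻¹) = BT.id S m := by
  ext q : 1
  simp [BT.permLeaves_homeo]

/-- Both exchanged leaves lie inside leaf `i` of `f`, so the support does as well. -/
theorem BT.permLeaves_swap_apply {l m n : ℕ} {g : BT S m n} {f : BT S l m} {a b : Fin n} {i : Fin m}
    {w w' : (S → ℕ → Bool) → (S → ℕ → Bool)} (ha : g.Leaf a i w) (hb : g.Leaf b i w')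
    {q : CantorPower S l} (hq : (f.homeo q).1 ≠ i) :
    ((g.comp f).permLeaves (Equiv.swap a b)).homeo q = q := by
  have key : ∀ {c w}, g.Leaf c i w → ((g.comp f).homeo q).1 ≠ c := by
    rintro c w hc rfl
    have := hc ((g.comp f).homeo q).2
    rw [Prod.mk.eta, BT.comp_homeo, Homeomorph.symm_apply_apply] at this
    exact hq (congrArg Prod.fst this)
  rw [BT.permLeaves_homeo, Equiv.swap_apply_of_ne_of_ne (key ha) (key hb), Prod.mk.eta,
    Homeomorph.symm_apply_apply]

theorem BT.comp_comm_of_disjoint {n : ℕ} {f g : BT S n n}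
    (h : ∀ q, f.homeo q = q ∨ g.homeo q = q) : f.comp g = g.comp f := by
  have hd : Equiv.Perm.Disjoint f.homeo.toEquiv g.homeo.toEquiv := h
  ext q : 1
  exact Equiv.Perm.congr_fun hd.commute q

end Refine

namespace TwistedHom

variable {G : Type u} {S : Type v} [Group G] [MulAction G S]

/-- Labelled permutations conjugate an exchange of two sibling leaves to an element of the
Brin–Thompson groupoid. -/
theorem exists_comp_permLeaves_siblings {n : ℕ} {μ : TwistedHom G S n n} (hμ : IsMonomial μ)
    (k : Fin n) (s : S) : ∃ f : BT S n n,
      μ.comp (of ((BT.split k s).permLeaves (Equiv.swap k.castSucc k.succ))) =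
        (of f).comp μ := by
  obtain ⟨σ, g, rfl⟩ := hμ
  let τ := Equiv.swap k.castSucc k.succ
  let x := BT.split k s
  let y := BT.split k (g k • s)
  let g' := fun j => g (k.predAbove j)
  refine ⟨(BT.perm S σ).comp ((y.permLeaves τ).comp (BT.perm S σ⁻¹)), ?_⟩
  -- Siblings inherit the same label from `k`, so exchanging them commutes with the labels. For
  -- arbitrary leaves this would fail.
  have hτ : (fun i => g' (τ i)) = g' := by
    funext i
    by_cases h1 : i = k.castSucc
    · subst h1; simp [g', τ]
    by_cases h2 : i = k.succ
    · subst h2; simp [g', τ]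
    · simp [τ, Equiv.swap_apply_of_ne_of_ne h1 h2]
  have h1 : (tw g' : TwistedHom G S (n + 1) (n + 1)).comp (of (BT.perm S τ)) =
      (of (BT.perm S τ)).comp (tw g') := by rw [tw_perm, hτ]
  have h2 : (of y).comp (tw g) = (tw g').comp (of x) := split_tw k s g
  have h3 : (tw g).comp (of (x.permLeaves τ)) = (of (y.permLeaves τ)).comp (tw g) := by
    apply comp_left_cancel (a := of y)
    simp only [BT.permLeaves, of_comp, of_inv]
    rw [← comp_assoc, h2]
    simp only [comp_assoc, comp_inv_cancel_left]
    rw [h2, ← comp_assoc, h1, comp_assoc]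
  have h4 : (of (BT.perm S σ⁻¹) : TwistedHom G S n n).comp (of (BT.perm S σ)) =
      of (BT.id S n) := by
    rw [← of_comp, BT.perm_mul, inv_mul_cancel, BT.perm_one]
  simp only [of_comp, comp_assoc]
  rw [← comp_assoc (of (BT.perm S σ⁻¹)), h4, id_comp, h3]

end TwistedHom

/-! ### Three-cycles from an element outside the canonical kernel. -/

section ThreeCycle

variable {G : Type u} {S : Type v} [Group G] [MulAction G S] {N : Subgroup (SV G S)}

open TwistedHom

/-- The commutator of `h` and `a` is `c * a⁻¹`. Its commutator with `b` is also in `N`, and there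
`c` cancels because it commutes with `a` and `b`. -/
theorem commutator_commutator_mem {H : Type*} [Group H] {N : Subgroup H} [hN : N.Normal]
    {h a b c : H} (hh : h ∈ N) (hc : h * a * h⁻¹ = c) (hca : Commute c a) (hcb : Commute c b) :
    a⁻¹ * b * a * b⁻¹ ∈ N := by
  have h1 : c * a⁻¹ ∈ N := by
    have := N.mul_mem hh (hN.conj_mem _ (N.inv_mem hh) a)
    rwa [show h * (a * h⁻¹ * a⁻¹) = c * a⁻¹ by rw [← hc]; group] at this
  have h2 := N.mul_mem h1 (hN.conj_mem _ (N.inv_mem h1) b)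
  have h3 : Commute c (a⁻¹ * b * a) := (hca.inv_right.mul_right hcb).mul_right hca
  have h4 : c * a⁻¹ * (b * (c * a⁻¹)⁻¹ * b⁻¹) = c * (a⁻¹ * b * a) * c⁻¹ * b⁻¹ := by group
  rwa [h4, h3.eq, mul_inv_cancel_right] at h2

/-- Inside a leaf `j` that `h` moves off itself, three leaves `a`, `b`, `c` are cut out. `α` swaps
the siblings `a` and `b`, so its conjugate by `h` carries no labels. That conjugate is therefore
determined by its action on points, and disjointness of supports makes it commute with `α` and `β`.
`β` is never conjugated, so `b` and `c` need not be siblings. -/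
theorem exists_alternatingGroup_le_permKer [Nonempty S] [hN : N.Normal] {h : SV G S} (hh : h ∈ N)
    (hK : h ∉ canonicalKernel G S) : ∃ n, 4 ≤ n ∧ alternatingGroup (Fin n) ≤ permKer N n := by
  obtain ⟨s⟩ := ‹Nonempty S›
  obtain ⟨p, hp⟩ : ∃ p, TwistedHom.eval h p ≠ p := by
    by_contra! hc
    exact hK (mem_canonicalKernel_iff_eval.2 hc)
  obtain ⟨U, V, hU, hV, hpU, hpV, hUV⟩ := t2_separation hp.symm
  have hW : U ∩ TwistedHom.eval h ⁻¹' V ∈ nhds p :=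
    (hU.inter (hV.preimage (TwistedHom.eval h).continuous)).mem_nhds ⟨hpU, hpV⟩
  obtain ⟨n₀, Fm, Fp, μ, -, hFp, hμ, e⟩ := exists_normalForm h
  obtain ⟨n, C, hC, hleaf⟩ := hFp.exists_leaf_subset p hW
  set E := C.comp Fp with hE
  set j := (E.homeo p).1
  -- The leaf `j` of `E` is disjoint from its image.
  have hdisj : ∀ q, (E.homeo q).1 = j → (E.homeo (TwistedHom.eval h q)).1 ≠ j := fun q hq hq' =>
    Set.disjoint_left.1 hUV (hleaf _ hq').1 (hleaf _ hq).2
  -- A single leaf would contain its own image. The two further cuts then give at least four leaves.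
  have hn : 2 ≤ n := by
    rcases n with _ | _ | n
    · exact j.elim0
    · exact absurd (Fin.ext (by omega)) (hdisj p rfl)
    · omega
  set x := BT.split j s with hx
  -- Carrying the refinement past `μ` yields the normal form `F ∘ h = ν ∘ T`, in which `α` becomes a
  -- swap of siblings right of `ν`.
  obtain ⟨F', ν, -, hν, e'⟩ := exists_comp_isMonomial ((isForest_split j s).comp hC) hμ
  set T := x.comp E with hT
  set y := BT.split j.castSucc s with hy
  have hne : j.succ ≠ j.castSucc := (Fin.castSucc_lt_succ).ne'
  obtain ⟨c, hc⟩ := BT.exists_leaf_split_of_ne hne s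
  set a := j.castSucc.castSucc
  set b := j.castSucc.succ
  have hab : a ≠ b := (Fin.castSucc_lt_succ).ne
  have hca : c ≠ a := hc.ne (BT.leaf_split_castSucc _ _) hne
  have hcb : c ≠ b := hc.ne (BT.leaf_split_succ _ _) hne
  have hya : (y.comp x).Leaf a j _ :=
    (BT.leaf_split_castSucc _ s).comp (BT.leaf_split_castSucc j s)
  have hyb : (y.comp x).Leaf b j _ := (BT.leaf_split_succ _ s).comp (BT.leaf_split_castSucc j s)
  have hyc : (y.comp x).Leaf c j _ := hc.comp (BT.leaf_split_succ j s)
  obtain ⟨f, hf⟩ := exists_comp_permLeaves_siblings hν j.castSucc s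
  set R := (y.comp x).comp E with hR
  set α := R.permLeaves (Equiv.swap a b) with hα
  set β := R.permLeaves (Equiv.swap b c) with hβ
  set F := F'.comp Fm with hF
  set φ := F.inv.comp (f.comp F) with hφ
  have eF : (of F).comp h = ν.comp (of T) := by
    rw [hF, of_comp, comp_assoc, e, ← comp_assoc, e', comp_assoc, ← of_comp]
    rfl
  have eα : h.comp (of α) = (of φ).comp h := by
    apply comp_left_cancel (a := of F)
    have h1 : (of T).comp (of α) =
        (of (y.permLeaves (Equiv.swap a b)) : TwistedHom G S _ _).comp (of T) := by
      rw [← of_comp, ← of_comp]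
      exact congrArg of (BT.comp_permLeaves_comp y T _)
    have h2 : (of F).comp (of φ) = (of f : TwistedHom G S _ _).comp (of F) := by
      rw [← of_comp, ← of_comp, hφ, ← BT.comp_assoc, BT.comp_inv, BT.id_comp]
    rw [← comp_assoc, eF, comp_assoc, h1, ← comp_assoc, hf, ← comp_assoc (of F), h2, comp_assoc,
      comp_assoc, eF]
  have hconj : h * of α * h⁻¹ = of φ := by
    rw [mul_inv_eq_iff_eq_mul]
    exact eα
  have hφ_apply : ∀ q, φ.homeo (TwistedHom.eval h q) = TwistedHom.eval h (α.homeo q) := by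
    intro q
    have := congrArg (fun a => a.eval q) eα
    simpa using this.symm
  have hcomm : ∀ γ : BT S 1 1, (∀ q, (E.homeo q).1 ≠ j → γ.homeo q = q) →
      Commute (of φ : SV G S) (of γ) := by
    intro γ hγ
    change (of φ).comp (of γ) = (of γ).comp (of φ)
    rw [← of_comp, ← of_comp, BT.comp_comm_of_disjoint]
    intro q
    obtain ⟨q, rfl⟩ := (TwistedHom.eval h).surjective q
    by_cases hq : (E.homeo q).1 = j
    · exact .inr (hγ _ (hdisj q hq))
    · left
      rw [hφ_apply, hα, BT.permLeaves_swap_apply hya hyb hq]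
  have hmem := commutator_commutator_mem hh hconj
    (hcomm α fun q hq => BT.permLeaves_swap_apply hya hyb hq)
    (hcomm β fun q hq => BT.permLeaves_swap_apply hyb hyc hq)
  refine ⟨n + 1 + 1, by omega, alternatingGroup_le_of_mem hca hcb hab ?_⟩
  rw [mem_permKer]
  have hinv : ∀ {σ}, (of (R.permLeaves σ) : SV G S)⁻¹ = of (R.permLeaves σ⁻¹) := by
    intro σ
    rw [inv_eq_iff_mul_eq_one]
    change (of _).comp (of _) = _
    rw [← of_comp, BT.permLeaves_comp_inv]; rfl
  rw [hα, hβ, hinv, hinv, Equiv.swap_inv, Equiv.swap_inv] at hmem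
  simp only [TwistedHom.mul_def, ← of_comp, BT.permLeaves_mul] at hmem
  refine red_eq_id_of_mem (δ := of R) ?_
  rw [← of_inv, ← of_comp, ← of_comp]
  convert hmem using 2
  change R.permLeaves _ = _
  congr 1
  -- On leaves the commutator is `(a b)(b c)(a b)(b c) = (c a)(c b)`.
  rw [Equiv.swap_comm a b, Equiv.swap_comm b c, Equiv.swap_mul_swap_mul_swap hcb hca,
    Equiv.swap_comm a c]

end ThreeCycle

/-! ### Commuting splits -/

section Splits
variable {S : Type v}

theorem BT.exists_split_comm {n : ℕ} {k l : Fin n} (hkl : k ≠ l) (s t : S) :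
    ∃ (k' l' : Fin (n + 1)) (τ : Equiv.Perm (Fin (n + 1 + 1))),
      (BT.split l' t).comp (BT.split k s) =
        (BT.perm S τ).comp ((BT.split k' s).comp (BT.split l t)) := by
  obtain ⟨k', hk'⟩ := BT.exists_leaf_split_of_ne hkl t
  obtain ⟨l', hl'⟩ := BT.exists_leaf_split_of_ne hkl.symm s
  refine ⟨k', l', BT.exists_perm_comp fun j => ?_⟩
  rcases BT.leaf_split_cases k' s j with ⟨b, hb⟩ | ⟨i, hi, hj⟩
  · obtain ⟨e, he⟩ := BT.exists_leaf_split k s b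
    obtain ⟨j', hj'⟩ := BT.exists_leaf_split_of_ne (he.ne hl' hkl) t
    exact ⟨j', k, _, hb.comp hk', hj'.comp he⟩
  · rcases BT.leaf_split_cases l t i with ⟨c, hc⟩ | ⟨i', hi', hi''⟩
    · obtain ⟨j', hj'⟩ := BT.exists_leaf_split l' t c
      exact ⟨j', l, _, hj.comp hc, hj'.comp hl'⟩
    · have hne : i' ≠ k := by
        rintro rfl
        exact hi (hi''.unique hk')
      obtain ⟨e, he⟩ := BT.exists_leaf_split_of_ne hne s
      obtain ⟨j', hj'⟩ := BT.exists_leaf_split_of_ne (he.ne hl' hi') t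
      exact ⟨j', i', _, hj.comp hi'', hj'.comp he⟩

/-- Split copy `k` in direction `t`, and then both halves in direction `s`. -/
theorem BT.exists_split_halves {n : ℕ} (k : Fin n) (s t : S) :
    ∃ (e : Fin (n + 1)) (e' : Fin (n + 1 + 1)),
      (∀ j, (∃ b c, ((BT.split e' s).comp ((BT.split e s).comp (BT.split k t))).Leaf j k
          (cons t b ∘ cons s c)) ∨
        ∃ i, i ≠ k ∧ ((BT.split e' s).comp ((BT.split e s).comp (BT.split k t))).Leaf j i
          (fun κ => κ)) ∧
      (∀ b c, ∃ j, ((BT.split e' s).comp ((BT.split e s).comp (BT.split k t))).Leaf j k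
          (cons t b ∘ cons s c)) ∧
      ∀ i, i ≠ k → ∃ j, ((BT.split e' s).comp ((BT.split e s).comp (BT.split k t))).Leaf j i
          (fun κ => κ) := by
  have hne : k.succ ≠ k.castSucc := (Fin.castSucc_lt_succ).ne'
  obtain ⟨e', he'⟩ := BT.exists_leaf_split_of_ne hne s
  have h0 := BT.leaf_split_castSucc k t
  have h1 := BT.leaf_split_succ k t
  refine ⟨k.castSucc, e', fun j => ?_, ?_, fun i hi => ?_⟩
  · rcases BT.leaf_split_cases e' s j with ⟨c, hc⟩ | ⟨i, hi, hj⟩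
    · exact .inl ⟨true, c, hc.comp (he'.comp h1)⟩
    · rcases BT.leaf_split_cases k.castSucc s i with ⟨c, hc⟩ | ⟨i', hi', hi''⟩
      · exact .inl ⟨false, c, hj.comp (hc.comp h0)⟩
      · have hne' : i' ≠ k.succ := by
          rintro rfl
          exact hi (hi''.unique he')
        rcases BT.leaf_split_cases k t i' with ⟨b, hb⟩ | ⟨l, hl, hl'⟩
        · cases b
          · exact absurd (hb.unique h0) hi'
          · exact absurd (hb.unique h1) hne'
        · exact .inr ⟨l, hl, hj.comp (hi''.comp hl')⟩
  · rintro (_ | _) c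
    · obtain ⟨i, hi⟩ := BT.exists_leaf_split k.castSucc s c
      obtain ⟨j, hj⟩ := BT.exists_leaf_split_of_ne (hi.ne he' hne.symm) s
      exact ⟨j, hj.comp (hi.comp h0)⟩
    · obtain ⟨j, hj⟩ := BT.exists_leaf_split e' s c
      exact ⟨j, hj.comp (he'.comp h1)⟩
  · obtain ⟨a, ha⟩ := BT.exists_leaf_split_of_ne hi t
    obtain ⟨b, hb⟩ := BT.exists_leaf_split_of_ne (ha.ne h0 hi) s
    obtain ⟨j, hj⟩ := BT.exists_leaf_split_of_ne (hb.ne he' (ha.ne h1 hi)) s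
    exact ⟨j, hj.comp (hb.comp ha)⟩

/-- Cutting in directions `s` and `t` in either order gives the same four quarters, because letters
at different coordinates commute. -/
theorem BT.exists_split_halves_comm {n : ℕ} (k : Fin n) {s t : S} (hst : s ≠ t) :
    ∃ (d e : Fin (n + 1)) (d' e' : Fin (n + 1 + 1)) (τ : Equiv.Perm (Fin (n + 1 + 1 + 1))),
      (BT.split d' t).comp ((BT.split d t).comp (BT.split k s)) =
        (BT.perm S τ).comp ((BT.split e' s).comp ((BT.split e s).comp (BT.split k t))) := by
  obtain ⟨e, e', he, -, -⟩ := BT.exists_split_halves k s t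
  obtain ⟨d, d', -, hd, hd'⟩ := BT.exists_split_halves k t s
  refine ⟨d, e, d', e', BT.exists_perm_comp fun j => ?_⟩
  rcases he j with ⟨b, c, h⟩ | ⟨i, hi, h⟩
  · obtain ⟨j', hj'⟩ := hd c b
    refine ⟨j', k, _, h, ?_⟩
    have : cons t b ∘ cons s c = cons s c ∘ cons t b := funext fun κ => cons_comm hst.symm _ _ _
    rwa [this]
  · obtain ⟨j', hj'⟩ := hd' i hi
    exact ⟨j', i, _, h, hj'⟩

end Splits

section Trivial

variable {G : Type u} {S : Type v} [Group G] [MulAction G S] {N : Subgroup (SV G S)}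

open TwistedHom

/-! ### Everything is trivial once permutations are -/

theorem red_of_eq_of_perm (hN : ∀ n, permKer N n = ⊤) {m n : ℕ} {f f' : BT S m n}
    {τ : Equiv.Perm (Fin n)} (h : f' = (BT.perm S τ).comp f) : red N (of f') = red N (of f) := by
  have hτ : τ ∈ permKer N n := hN n ▸ Subgroup.mem_top τ
  rw [h, of_comp, red_comp, mem_permKer.1 hτ, Reduced.id_comp]

/-- Conjugate one split into the other by the transposition of `k` and `l`, which is trivial modulo
`N`. -/
theorem red_split_eq (hN : ∀ n, permKer N n = ⊤) {n : ℕ} (k l : Fin n) (s : S) :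
    red N (of (BT.split k s)) = red N (of (BT.split l s)) := by
  obtain ⟨τ, hτ⟩ := BT.exists_perm_split (Equiv.swap l k) l s
  rw [Equiv.swap_apply_left] at hτ
  have hσ : Equiv.swap l k ∈ permKer N n := hN n ▸ Subgroup.mem_top _
  rw [← red_of_eq_of_perm hN hτ, of_comp, red_comp, mem_permKer.1 hσ, Reduced.comp_id]

variable (N) in
/-- The class of a simple split in direction `s` on one of `n + 1` copies. -/
noncomputable def redSplit (n : ℕ) (s : S) : Reduced N (n + 1) (n + 1 + 1) :=
  red N (of (BT.split (0 : Fin (n + 1)) s))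

theorem red_split (hN : ∀ n, permKer N n = ⊤) {n : ℕ} (k : Fin (n + 1)) (s : S) :
    red N (of (BT.split k s)) = redSplit N n s := red_split_eq hN k 0 s

/-- The two splits may be placed on different copies, where they commute; hence the start with `n +
2` copies. -/
theorem redSplit_comm (hN : ∀ n, permKer N n = ⊤) (n : ℕ) (s t : S) :
    (redSplit N (n + 2) t).comp (redSplit N (n + 1) s) =
      (redSplit N (n + 2) s).comp (redSplit N (n + 1) t) := by
  obtain ⟨k', l', τ, h⟩ := BT.exists_split_comm (zero_ne_one (α := Fin (n + 2))) s t
  have := red_of_eq_of_perm hN h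
  simpa only [of_comp, red_comp, red_split hN] using this

theorem redSplit_halves (hN : ∀ n, permKer N n = ⊤) (n : ℕ) {s t : S} (hst : s ≠ t) :
    (redSplit N (n + 2) t).comp ((redSplit N (n + 1) t).comp (redSplit N n s)) =
      (redSplit N (n + 2) s).comp ((redSplit N (n + 1) s).comp (redSplit N n t)) := by
  obtain ⟨d, e, d', e', τ, h⟩ := BT.exists_split_halves_comm (0 : Fin (n + 1)) hst
  have := red_of_eq_of_perm hN h
  simpa only [of_comp, red_comp, red_split hN] using this

/-- Modulo `N`, a split does not depend on its direction. -/
theorem redSplit_eq (hN : ∀ n, permKer N n = ⊤) (n : ℕ) (s t : S) :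
    redSplit N n s = redSplit N n t := by
  by_cases hst : s = t
  · rw [hst]
  -- Writing only directions, `s s t = t t s = t s t = s t t`: the first equality is the relation of
  -- quarters, the others commute splits. Cancelling gives `s = t` in the middle.
  have high : ∀ m, redSplit N (m + 2) t = redSplit N (m + 2) s := by
    intro m
    apply Reduced.comp_right_cancel (a := redSplit N (m + 1) t)
    apply Reduced.comp_left_cancel (a := redSplit N (m + 3) s)
    rw [← redSplit_halves hN (m + 1) hst, redSplit_comm hN m s t, ← Reduced.comp_assoc,
      ← Reduced.comp_assoc, redSplit_comm hN (m + 1) s t]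
  -- With few copies splits need not commute, so equality descends from the two higher levels
  -- through `t t s = s s t`.
  have low : ∀ m, redSplit N (m + 2) t = redSplit N (m + 2) s →
      redSplit N (m + 1) t = redSplit N (m + 1) s → redSplit N m s = redSplit N m t := by
    intro m h2 h1
    have := redSplit_halves hN m hst
    rw [h2, h1] at this
    exact Reduced.comp_left_cancel (Reduced.comp_left_cancel this)
  have one := low 1 (high 1) (high 0)
  rcases n with _ | _ | n
  · exact low 0 (high 0) one.symm
  · exact one
  · exact (high n).symm

variable (N) in
/-- The tuples of labels that become trivial modulo `N`. -/
def twistKer (n : ℕ) : Subgroup (Fin n → G) where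
  carrier := {g | red N (tw g) = red N (of (BT.id S n))}
  mul_mem' {g g'} hg hg' := by
    rw [Set.mem_ofPred_eq] at hg hg' ⊢
    rw [tw_mul, red_comp, hg, hg', Reduced.id_comp]
  one_mem' := by rw [Set.mem_ofPred_eq, tw_one]
  inv_mem' {g} hg := by
    rw [Set.mem_ofPred_eq] at hg ⊢
    apply Reduced.comp_left_cancel (a := red N (tw g))
    rw [← red_comp, ← tw_mul, mul_inv_cancel, tw_one, hg, Reduced.id_comp]

theorem mem_twistKer {n : ℕ} {g : Fin n → G} :
    g ∈ twistKer N n ↔ red N (tw g) = red N (of (BT.id S n)) := Iff.rfl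

theorem redSplit_comp_tw (hN : ∀ n, permKer N n = ⊤) {n : ℕ} (s : S) (k : Fin (n + 1))
    (g : Fin (n + 1) → G) : (redSplit N n s).comp (red N (tw g)) =
      (red N (tw fun j => g (k.predAbove j))).comp (redSplit N n s) := by
  have := congrArg (red N) (split_tw k s g)
  rwa [red_comp, red_comp, red_split hN, red_split hN, redSplit_eq hN n _ s] at this

/-- Pass `(u, 1, …, 1)` through a split at position `0` and at position `1`. The results `(u, u, 1,
…)` and `(u, 1, 1, …)` agree modulo `N`, so `(1, u, 1, …)` is trivial; a transposition moves `u` to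
any place. -/
theorem mulSingle_mem_twistKer [Nonempty S] (hN : ∀ n, permKer N n = ⊤) (n : ℕ) (u : G)
    (i : Fin (n + 3)) : Pi.mulSingle i u ∈ twistKer N (n + 3) := by
  obtain ⟨s⟩ := ‹Nonempty S›
  have key : (Pi.mulSingle 1 u : Fin (n + 3) → G) ∈ twistKer N (n + 3) := by
    have h := (redSplit_comp_tw hN s 0 (Pi.mulSingle (0 : Fin (n + 2)) u)).symm.trans
      (redSplit_comp_tw hN s 1 (Pi.mulSingle (0 : Fin (n + 2)) u))
    have h := Reduced.comp_right_cancel h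
    have e0 : (fun j => (Pi.mulSingle (0 : Fin (n + 2)) u : Fin (n + 2) → G)
        ((0 : Fin (n + 2)).predAbove j)) = Pi.mulSingle (0 : Fin (n + 3)) u * Pi.mulSingle 1 u := by
      funext j
      refine Fin.cases ?_ (fun j => ?_) j
      · simp
      · have hj : (0 : Fin (n + 2)).predAbove j.succ = j := Fin.predAbove_zero_succ
        rw [hj, Pi.mul_apply, Pi.mulSingle_eq_of_ne (Fin.succ_ne_zero j), one_mul,
          Pi.mulSingle_apply, Pi.mulSingle_apply, ← Fin.succ_zero_eq_one]
        simp only [Fin.succ_inj]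
    have e1 : (fun j => (Pi.mulSingle (0 : Fin (n + 2)) u : Fin (n + 2) → G)
        ((1 : Fin (n + 2)).predAbove j)) = Pi.mulSingle (0 : Fin (n + 3)) u := by
      funext j
      refine Fin.cases ?_ (fun j => ?_) j
      · simp
      · rw [← Fin.succ_zero_eq_one, Fin.succ_predAbove_succ]
        simp
    rw [e0, e1, tw_mul, red_comp] at h
    refine mem_twistKer.2 (Reduced.comp_left_cancel (h.trans (Reduced.comp_id _).symm))
  have hσ : Equiv.swap 1 i ∈ permKer N (n + 3) := hN _ ▸ Subgroup.mem_top _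
  have h := congrArg (red N) (tw_perm (S := S) (Equiv.swap 1 i) (Pi.mulSingle 1 u))
  rw [red_comp, red_comp, mem_permKer.1 hσ, Reduced.comp_id, Reduced.id_comp,
    mem_twistKer.1 key] at h
  rw [mem_twistKer, h]
  congr 2
  funext j
  by_cases hj : j = i
  · subst hj; simp
  · have : Equiv.swap 1 i j ≠ 1 := fun hc => hj (by
      rw [← Equiv.swap_apply_left 1 i] at hc
      simpa using (Equiv.swap 1 i).injective (hc.trans (by simp)))
    rw [Pi.mulSingle_eq_of_ne hj, Pi.mulSingle_eq_of_ne this]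

theorem twistKer_eq_top [Nonempty S] (hN : ∀ n, permKer N n = ⊤) (n : ℕ) :
    twistKer N (n + 1) = ⊤ := by
  have high : ∀ n, twistKer N (n + 3) = ⊤ := fun n => eq_top_iff.2 fun g _ =>
    Subgroup.pi_mem_of_mulSingle_mem g fun i => mulSingle_mem_twistKer hN n (g i) i
  -- Below three copies, splitting turns a tuple into one that is already trivial, and the split
  -- cancels.
  have low : ∀ n, twistKer N (n + 2) = ⊤ → twistKer N (n + 1) = ⊤ := by
    intro n h
    obtain ⟨s⟩ := ‹Nonempty S›
    refine eq_top_iff.2 fun g _ => mem_twistKer.2 ?_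
    have h' : (fun j => g ((0 : Fin (n + 1)).predAbove j)) ∈ twistKer N (n + 2) :=
      h ▸ Subgroup.mem_top _
    have h2 := redSplit_comp_tw hN s 0 g
    rw [mem_twistKer.1 h', Reduced.id_comp] at h2
    exact Reduced.comp_left_cancel (h2.trans (Reduced.comp_id _).symm)
  rcases n with _ | _ | n
  exacts [low 0 (low 1 (high 0)), low 1 (high 0), high n]

variable (N) in
/-- The class of a tree with `n + 1` leaves. -/
noncomputable def redTree (s : S) : ∀ n : ℕ, Reduced N 1 (n + 1)
  | 0 => red N (of (BT.id S 1))
  | n + 1 => (redSplit N n s).comp (redTree s n)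

/-- Neither position nor direction of a split matters, so each one just lengthens the standard tree.
The numbers of roots and leaves enter through equations so that induction on the forest applies. -/
theorem IsForest.red_comp_redTree (hN : ∀ n, permKer N n = ⊤) (s : S) {m n : ℕ} {F : BT S m n}
    (hF : IsForest F) : ∀ (m' : ℕ) (hm : m = m' + 1), ∃ (n' : ℕ) (hn : n = n' + 1),
      (red N (of F)).comp (hm ▸ redTree N s m') = hn ▸ redTree N s n' := by
  induction hF with
  | id => exact fun m' hm => ⟨m', hm, Reduced.id_comp _⟩
  | split F k t _ ih =>
    intro m' hm
    obtain ⟨n', rfl, h⟩ := ih m' hm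
    refine ⟨n' + 1, rfl, ?_⟩
    rw [of_comp, red_comp, Reduced.comp_assoc, h, red_split hN, redSplit_eq hN n' t s]
    rfl

theorem IsForest.red_eq_redTree (hN : ∀ n, permKer N n = ⊤) (s : S) {n : ℕ} {F : BT S 1 n}
    (hF : IsForest F) : ∃ (n' : ℕ) (hn : n = n' + 1), red N (of F) = hn ▸ redTree N s n' := by
  obtain ⟨n', hn, h⟩ := hF.red_comp_redTree hN s 0 rfl
  exact ⟨n', hn, by rw [← h]; exact (Reduced.comp_id _).symm⟩

/-- In a normal form `F₋ ∘ h = μ ∘ F₊` the factor `μ` is trivial modulo `N`, and the trees `F₋`,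
`F₊` have equally many leaves, hence the same class; cancelling it makes `h` trivial. -/
theorem eq_top_of_permKer_eq_top [Nonempty S] [N.Normal] (hN : ∀ n, permKer N n = ⊤) :
    N = ⊤ := by
  obtain ⟨s⟩ := ‹Nonempty S›
  refine eq_top_iff.2 fun h _ => ?_
  obtain ⟨n, Fm, Fp, _, hFm, hFp, ⟨σ, g, rfl⟩, e⟩ := exists_normalForm h
  obtain ⟨n', rfl, hm⟩ := hFm.red_eq_redTree hN s
  obtain ⟨n'', hn, hp⟩ := hFp.red_eq_redTree hN s
  obtain rfl : n'' = n' := by omega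
  have hσ : σ ∈ permKer N (n'' + 1) := hN _ ▸ Subgroup.mem_top σ
  have hg : g ∈ twistKer N (n'' + 1) := twistKer_eq_top hN n'' ▸ Subgroup.mem_top g
  have e' := congrArg (red N) e
  rw [red_comp, red_comp, red_comp, mem_permKer.1 hσ, mem_twistKer.1 hg, Reduced.id_comp,
    Reduced.id_comp, hm, hp] at e'
  exact red_eq_id_iff_mem.1 (Reduced.comp_left_cancel (e'.trans (Reduced.comp_id _).symm))

theorem le_canonicalKernel [Nonempty S] (M : Subgroup (SV G S)) (hM : M.Normal) (h : M ≠ ⊤) :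
    M ≤ canonicalKernel G S := by
  intro a ha
  by_contra hK
  obtain ⟨n, hn, hA⟩ := exists_alternatingGroup_le_permKer ha hK
  exact h (eq_top_of_permKer_eq_top (permKer_eq_top hn hA))

theorem isRelativelySimplePair_canonicalKernel [Nonempty S] :
    IsRelativelySimplePair (canonicalKernel G S) :=
  ⟨MonoidHom.normal_ker _, canonicalKernel_ne_top, le_canonicalKernel⟩

end Trivial

end BrinThompson

theorem theoremA (G : Type*) (S : Type*) [Group G] [MulAction G S] [Nonempty S] :
    BrinThompson.IsRelativelySimple (BrinThompson.SV G S) ∧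
    BrinThompson.IsRelativelySimplePair (BrinThompson.canonicalKernel G S) ∧
    (∀ h : BrinThompson.SV G S, h ∈ BrinThompson.canonicalKernel G S ↔
      ∃ (n : ℕ) (T : BrinThompson.BT S 1 n) (k : Fin n → G), BrinThompson.IsForest T ∧
        (∀ i, k i ∈ (MulAction.toPermHom G S).ker) ∧
        h = BrinThompson.TwistedHom.quadruple T 1 k T) :=
  ⟨⟨_, BrinThompson.isRelativelySimplePair_canonicalKernel⟩,
    BrinThompson.isRelativelySimplePair_canonicalKernel,
    fun _ => BrinThompson.mem_canonicalKernel_iff⟩
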